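/- For $t\in\mathbb R$ let $a_n(t),b_n(t),c_n(t),d_n(t)$, $n\ge 1$, be complex numbers with $d_n(t)\neq 0$ for all $n\ge1$ and $t$, and put $a_n=b_n=c_n=d_n=0$ for $n\le 0$. A dot denotes $d/dt$; each of the differential equations below includes the assertion that the derivative exists, and is required for all $t\in\mathbb R$. Let $J=J(t)$ be the infinite matrix with rows and columns numbered $1,2,\dots$, with entries $J_{n,n+2}=1$, $J_{n,n+1}=a_{n+1}$, $J_{n,n}=b_n$, $J_{n+1,n}=c_n$, $J_{n+2,n}=d_n$ for $n\ge1$, and all other entries zero; let $J_-$ be its strictly lower triangular part, and let $\|J\|$ be the norm of $J$ as an operator on $\ell^2$. For an infinite matrix $X$ let $X_{11}$ be its upper left $2\times2$ block, and write $J^n_{11}=(J^n)_{11}$. Let $p_0=1$, $p_1(x)=x-a_1$, and let the monic polynomials $p_n$ be given by $$x^2p_n=p_{n+2}+a_{n+2}p_{n+1}+b_{n+1}p_n+c_np_{n-1}+d_{n-1}p_{n-2},\qquad n\ge0,\quad p_{-1}=p_{-2}=0 .$$ Put $\mathcal B_m=[p_{2m}\ \ p_{2m+1}]^T$, $\mathcal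 B_{-1}=0$, $\mathcal P_0(x)=[1\ \ x]^T$, and let $V_m$ be the $2\times2$ matrix polynomial with $\mathcal B_m(x)=V_m(x^2)\mathcal P_0(x)$, $V_{-1}=0$. Put $$C_m=\begin{bmatrix} d_{2m-1}&c_{2m}\\0&d_{2m}\end{bmatrix},\qquad D_m=\begin{bmatrix}0&0\\c_{2m+1}&0\end{bmatrix}.$$ A vector $\mathcal U=[u^1\ \ u^2]^T$ of linear functionals on $\mathbb C[x]$ acts on $\mathcal P=[P_1\ \ P_2]^T\in\mathbb P^2=\mathbb C[x]^2$ by $\mathcal U(\mathcal P)=(\langle u^j,P_i\rangle)_{i,j=1,2}$. Let $\mathcal U=\mathcal U(t)$ be the vector of linear functionals that is normalized, $\mathcal U(\mathcal P_0)=I$, and with respect to which $(\mathcal B_m)$ is left-orthogonal: $\mathcal U(x^{2k}\mathcal B_m)=0$ for $0\le k<m$, and $\mathcal U(x^{2m}\mathcal B_m)$ is nonsingular for all $m\ge0$. (It exists and is unique.) Let $\mathcal U_n=\mathcal U(x^{2n}\mathcal P_0)$ be its moments and $\mathcal F(z)=\sum_{n=0}^\infty \mathcal U_n/z^{n+1}$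 its generalized Markov function. Assume that there is a $K$ with $\max\{|a_n(t)|,|b_n(t)|,|c_n(t)|,|d_n(t)|\}\le K$ for all $n\ge1$ and $t\in\mathbb R$, and that $\dot a_1=c_1$. Then the following conditions are equivalent: (a) $\{a_n,b_n,c_n,d_n\}$ is a solution of the full Kostant–Toda system $$\dot a_n=c_n-c_{n-2},\quad \dot b_n=c_na_{n+1}-c_{n-1}a_n+d_n-d_{n-2},\quad \dot c_n=c_n(b_{n+1}-b_n)+d_na_{n+2}-d_{n-1}a_n,\quad \dot d_n=d_n(b_{n+2}-b_n),\qquad n\ge1;$$ that is, equivalently, the Lax equation $\dot J=JJ_--J_-J$ holds (entrywise); (b) $\frac{d}{dt}J^n_{11}=J^{n+1}_{11}-J^n_{11}J_{11}+J^n_{11}(J_-)_{11}-(J_-)_{11}J^n_{11}$ for all $n\ge0$; (c) $\dot{\mathcal U}_n=\mathcal U_{n+1}-\mathcal U_n\mathcal U_1$ for all $n\ge0$; (d) $\dot{\mathcal F}(z)=\mathcal F(z)(zI-\mathcal U_1)-I$ at every $t$ and every $z\in\mathbb C$ with $|z|>\|J(t)\|$; (e) $\left(\frac{d}{dt}\mathcal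 U\right)(\mathcal B)=\mathcal U(x^2\mathcal B)-\mathcal U(\mathcal B)\,\mathcal U_1$ for all $\mathcal B\in\mathbb P^2$; (f) $\dot{\mathcal B}_m(x)=-C_m\mathcal B_{m-1}(x)-D_m\mathcal B_m(x)$ for all $m\ge0$; (g) $\dot V_m(x)=-C_mV_{m-1}(x)-D_mV_m(x)$ for all $m\ge0$. -/

import Mathlib

open Polynomial
open scoped ENNReal

namespace KostantToda

/-- The values `a_n, b_n, c_n, d_n` (at one time) of the four coefficient sequences. Only the
indices `n ≥ 1` are meaningful; the value at index `0` is never used. -/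
structure Coeffs where
  a : ℕ → ℂ
  b : ℕ → ℂ
  c : ℕ → ℂ
  d : ℕ → ℂ

/-- The entry `f_{n-k}` of a sequence `(f_n)_{n ≥ 1}`, read as `0` when `n - k ≤ 0`. -/
def lag (f : ℕ → ℂ) (n k : ℕ) : ℂ := if k < n then f (n - k) else 0

/-- The preceding term `f_{m-1}` of a sequence `(f_m)_{m ≥ 0}`, with `f_{-1} = 0`. -/
def prev {α : Type} [Zero α] (f : ℕ → α) : ℕ → α
  | 0 => 0
  | m + 1 => f m

/-! ### Derivatives in time of matrices and polynomials -/

/-- Entrywise derivative of a time dependent `2 × 2` matrix. -/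
def MatHasDerivAt (X : ℝ → Matrix (Fin 2) (Fin 2) ℂ) (X' : Matrix (Fin 2) (Fin 2) ℂ)
    (t : ℝ) : Prop :=
  ∀ i j, HasDerivAt (fun s => X s i j) (X' i j) t

/-- Coefficientwise derivative, with respect to time, of a time dependent polynomial. -/
def PolyHasDerivAt (p : ℝ → ℂ[X]) (p' : ℂ[X]) (t : ℝ) : Prop :=
  ∀ k, HasDerivAt (fun s => (p s).coeff k) (p'.coeff k) t

/-! ### The infinite matrices `J` and `J_-` -/

/-- The infinite five diagonal matrix `J`; row and column `i` here are row and column `i + 1` of the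
usual numbering from `1`. -/
def jacobi (q : Coeffs) : Matrix ℕ ℕ ℂ := Matrix.of fun i j =>
  if j = i + 2 then 1
  else if j = i + 1 then q.a (i + 2)
  else if j = i then q.b (i + 1)
  else if i = j + 1 then q.c (j + 1)
  else if i = j + 2 then q.d (j + 1)
  else 0

/-- The strictly lower triangular part `J_-` of `J`. -/
def jacobiMinus (q : Coeffs) : Matrix ℕ ℕ ℂ := Matrix.of fun i j =>
  if j < i then jacobi q i j else 0

/-- Product of infinite matrices (all sums that occur below have finitely many nonzero terms). -/
noncomputable def infMul (A B : Matrix ℕ ℕ ℂ) : Matrix ℕ ℕ ℂ := Matrix.of fun i j =>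
  ∑' k, A i k * B k j

/-- Powers of an infinite matrix. -/
noncomputable def infPow (A : Matrix ℕ ℕ ℂ) : ℕ → Matrix ℕ ℕ ℂ
  | 0 => 1
  | n + 1 => infMul (infPow A n) A

/-- The upper left `2 × 2` block of an infinite matrix. -/
def block11 (A : Matrix ℕ ℕ ℂ) : Matrix (Fin 2) (Fin 2) ℂ := Matrix.of fun i j => A i j

/-- The norm of an infinite matrix as an operator on the Hilbert space `ℓ²` (with the value `∞` when
the matrix does not define a bounded operator). -/
noncomputable def l2OpNorm (A : Matrix ℕ ℕ ℂ) : ℝ≥0∞ :=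
  ⨆ (x : lp (fun _ : ℕ => ℂ) 2) (_ : ‖x‖ ≤ 1), (∑' i, ‖∑' j, A i j * x j‖ₑ ^ 2) ^ (1 / 2 : ℝ)

/-! ### The `2 × 2` blocks -/

/-- `A_m`. -/
def blockA (q : Coeffs) (m : ℕ) : Matrix (Fin 2) (Fin 2) ℂ := !![1, 0; q.a (2 * m + 3), 1]

/-- `B_m`. -/
def blockB (q : Coeffs) (m : ℕ) : Matrix (Fin 2) (Fin 2) ℂ :=
  !![q.b (2 * m + 1), q.a (2 * m + 2); q.c (2 * m + 1), q.b (2 * m + 2)]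

/-- `C_m`, with rows `d_{2m-1}, c_{2m}` and `0, d_{2m}` for `m ≥ 1`, and with `C_0 = 0`. -/
def blockC (q : Coeffs) : ℕ → Matrix (Fin 2) (Fin 2) ℂ
  | 0 => 0
  | m + 1 => !![q.d (2 * m + 1), q.c (2 * m + 2); 0, q.d (2 * m + 2)]

/-- `D_m`. -/
def blockD (q : Coeffs) (m : ℕ) : Matrix (Fin 2) (Fin 2) ℂ := !![0, 0; q.c (2 * m + 1), 0]

/-! ### The polynomials -/

/-- The monic polynomials `p_n` given by `p_0 = 1`, `p_1 = x - a_1` and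
`x² p_n = p_{n+2} + a_{n+2} p_{n+1} + b_{n+1} p_n + c_n p_{n-1} + d_{n-1} p_{n-2}` for `n ≥ 0`, where
`p_{-1} = p_{-2} = 0`. -/
noncomputable def poly (q : Coeffs) : ℕ → ℂ[X]
  | 0 => 1
  | 1 => X - C (q.a 1)
  | 2 => X ^ 2 * poly q 0 - C (q.a 2) * poly q 1 - C (q.b 1) * poly q 0
  | 3 => X ^ 2 * poly q 1 - C (q.a 3) * poly q 2 - C (q.b 2) * poly q 1 - C (q.c 1) * poly q 0
  | n + 4 => X ^ 2 * poly q (n + 2) - C (q.a (n + 4)) * poly q (n + 3)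
      - C (q.b (n + 3)) * poly q (n + 2) - C (q.c (n + 2)) * poly q (n + 1)
      - C (q.d (n + 1)) * poly q n

/-- The vector polynomial `ℬ_m = [p_{2m}, p_{2m+1}]ᵀ`. -/
noncomputable def vecPoly (q : Coeffs) (m : ℕ) : Fin 2 → ℂ[X] :=
  ![poly q (2 * m), poly q (2 * m + 1)]

/-- The vector polynomial `𝒫_0 = [1, x]ᵀ`. -/
noncomputable def vecP0 : Fin 2 → ℂ[X] := ![1, X]

/-- The matrix polynomial `V_m` with `ℬ_m(x) = V_m(x²) 𝒫_0(x)`: its first column collects the even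
parts, its second column the odd parts, of the components of `ℬ_m`. -/
noncomputable def matPoly (q : Coeffs) (m : ℕ) : Matrix (Fin 2) (Fin 2) ℂ[X] := Matrix.of fun i j =>
  if j = 0 then contract 2 (vecPoly q m i) else contract 2 (divX (vecPoly q m i))

/-- A numerical matrix as a constant matrix polynomial. -/
noncomputable def constMat (A : Matrix (Fin 2) (Fin 2) ℂ) : Matrix (Fin 2) (Fin 2) ℂ[X] := A.map C

/-! ### Vectors of linear functionals -/

/-- The value `𝒰(𝒫)` of a vector of linear functionals `𝒰 = [u¹, u²]ᵀ` at `𝒫 = [p₁, p₂]ᵀ`: the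
`2 × 2` matrix with entries `⟨u^j, p_i⟩`. -/
noncomputable def vecApply (u : Fin 2 → ℂ[X] →ₗ[ℂ] ℂ) (P : Fin 2 → ℂ[X]) : Matrix (Fin 2) (Fin 2) ℂ :=
  Matrix.of fun i j => u j (P i)

/-- The moment `𝒰_n = 𝒰(x^{2n} 𝒫_0)`. -/
noncomputable def moment (u : Fin 2 → ℂ[X] →ₗ[ℂ] ℂ) (n : ℕ) : Matrix (Fin 2) (Fin 2) ℂ :=
  vecApply u ((X ^ (2 * n) : ℂ[X]) • vecP0)

/-- `𝒰` is normalized: `𝒰(𝒫_0) = I`. -/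
def IsNormalized (u : Fin 2 → ℂ[X] →ₗ[ℂ] ℂ) : Prop := vecApply u vecP0 = 1

/-- A sequence of vector polynomials is left-orthogonal with respect to `𝒰`:
`(x^{2k} 𝒰)(ℬ_m) = Δ_m δ_{k,m}` for `0 ≤ k ≤ m`, with nonsingular matrices `Δ_m`. -/
def IsLeftOrthogonal (u : Fin 2 → ℂ[X] →ₗ[ℂ] ℂ) (B : ℕ → Fin 2 → ℂ[X]) : Prop :=
  ∃ Δ : ℕ → Matrix (Fin 2) (Fin 2) ℂ, (∀ m, (Δ m).det ≠ 0) ∧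
    ∀ m, ∀ k ≤ m, vecApply u ((X ^ (2 * k) : ℂ[X]) • B m) = if k = m then Δ m else 0

/-- The generalized Markov function `ℱ(z) = ∑_n 𝒰_n / z^{n+1}`. -/
noncomputable def markov (u : Fin 2 → ℂ[X] →ₗ[ℂ] ℂ) (z : ℂ) : Matrix (Fin 2) (Fin 2) ℂ :=
  ∑' n : ℕ, (z ^ (n + 1))⁻¹ • moment u n

/-! ### Checks of the definitions -/

/-- `ℬ_m(x) = V_m(x²) 𝒫_0(x)`. -/
theorem vecPoly_eq (q : Coeffs) (m : ℕ) :
    vecPoly q m = ((matPoly q m).map (expand ℂ 2)).mulVec vecP0 := by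
  funext i
  have key : ∀ p : ℂ[X], p = expand ℂ 2 (contract 2 p) + expand ℂ 2 (contract 2 (divX p)) * X := by
    intro p
    ext k
    rcases k with _ | k
    · simp [coeff_expand, coeff_contract]
    · simp only [coeff_add, coeff_mul_X, coeff_expand (by norm_num : 0 < 2),
        coeff_contract (by norm_num : (2 : ℕ) ≠ 0), coeff_divX]
      rcases Nat.even_or_odd' k with ⟨l, rfl | rfl⟩
      · rw [if_neg (by omega), if_pos (by omega)]
        simp [mul_comm]
      · rw [if_pos (by omega), if_neg (by omega)]
        rw [Nat.div_mul_cancel (by omega), add_zero]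
  simpa [Matrix.mulVec, dotProduct, Fin.sum_univ_two, matPoly, vecP0] using key (vecPoly q m i)

/-- The three term recurrence relation
`x² ℬ_m(x) = A_m ℬ_{m+1}(x) + B_m ℬ_m(x) + C_m ℬ_{m-1}(x)`. -/
theorem vecPoly_rec (q : Coeffs) (m : ℕ) :
    (X ^ 2 : ℂ[X]) • vecPoly q m = (constMat (blockA q m)).mulVec (vecPoly q (m + 1))
      + (constMat (blockB q m)).mulVec (vecPoly q m)
      + (constMat (blockC q m)).mulVec (prev (vecPoly q) m) := by
  funext i
  rcases m with _ | m <;> fin_cases i <;>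
    simp [constMat, blockA, blockB, blockC, prev, vecPoly, poly, mul_add] <;> ring

/-- `p_n` has degree `n`. -/
theorem degree_poly (q : Coeffs) (n : ℕ) : (poly q n).degree = (n : WithBot ℕ) := by
  have lt : ∀ {r : ℂ[X]} {x : ℂ} {k l : ℕ}, r.degree = (k : WithBot ℕ) → k < l →
      (C x * r).degree < (l : WithBot ℕ) := by
    intro r x k l hr hkl
    rw [← smul_eq_C_mul]
    exact (degree_smul_le x r).trans_lt (by rw [hr]; exact_mod_cast hkl)
  have top : ∀ {r : ℂ[X]} {k : ℕ}, r.degree = (k : WithBot ℕ) →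
      (X ^ 2 * r).degree = ((k + 2 : ℕ) : WithBot ℕ) := by
    intro r k hr
    rw [degree_mul, degree_X_pow, hr, add_comm]
    push_cast
    rfl
  have sub : ∀ {r s : ℂ[X]} {k : ℕ}, r.degree = (k : WithBot ℕ) → s.degree < (k : WithBot ℕ) →
      (r - s).degree = (k : WithBot ℕ) := by
    intro r s k hr hs
    rw [degree_sub_eq_left_of_degree_lt (by rwa [hr]), hr]
  induction n using Nat.strong_induction_on with
  | _ n ih =>
    match n, ih with
    | 0, _ => simp [poly]
    | 1, _ => simp [poly]
    | 2, ih =>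
      rw [poly]
      exact sub (sub (top (ih 0 (by omega))) (lt (ih 1 (by omega)) (by omega)))
        (lt (ih 0 (by omega)) (by omega))
    | 3, ih =>
      rw [poly]
      exact sub (sub (sub (top (ih 1 (by omega))) (lt (ih 2 (by omega)) (by omega)))
        (lt (ih 1 (by omega)) (by omega))) (lt (ih 0 (by omega)) (by omega))
    | n + 4, ih =>
      rw [poly]
      exact sub (sub (sub (sub (top (ih (n + 2) (by omega)))
        (lt (ih (n + 3) (by omega)) (by omega))) (lt (ih (n + 2) (by omega)) (by omega)))
        (lt (ih (n + 1) (by omega)) (by omega))) (lt (ih n (by omega)) (by omega))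

theorem vecApply_mul (u : Fin 2 → ℂ[X] →ₗ[ℂ] ℂ) (A : Matrix (Fin 2) (Fin 2) ℂ)
    (P : Fin 2 → ℂ[X]) (r : ℂ[X]) :
    vecApply u (r • (constMat A).mulVec P) = A * vecApply u (r • P) := by
  ext i j
  simp only [vecApply, constMat, Matrix.mulVec, dotProduct, Fin.sum_univ_two, Matrix.mul_apply,
    Matrix.of_apply, Pi.smul_apply, Matrix.map_apply, smul_eq_mul, mul_add, map_add]
  congr 1 <;> rw [mul_left_comm, ← smul_eq_C_mul, map_smul, smul_eq_mul]

theorem vecApply_add (u : Fin 2 → ℂ[X] →ₗ[ℂ] ℂ) (P Q : Fin 2 → ℂ[X]) :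
    vecApply u (P + Q) = vecApply u P + vecApply u Q := by
  ext i j
  simp [vecApply]

/-- When all `d_n` are nonzero, a normalized vector of linear functionals with respect to which
`(ℬ_m)` is left-orthogonal exists, and it is unique. -/
theorem existsUnique_functional (q : Coeffs) (hd : ∀ n, 1 ≤ n → q.d n ≠ 0) :
    ∃! u : Fin 2 → ℂ[X] →ₗ[ℂ] ℂ, IsNormalized u ∧ IsLeftOrthogonal u (vecPoly q) := by
  let S : Polynomial.Sequence ℂ := ⟨poly q, degree_poly q⟩
  have hS : ∀ i, IsUnit (S i).leadingCoeff := fun i => (S.ne_zero i |> fun h => by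
    simpa using h)
  let e := S.basis hS
  have he : ∀ n, e n = poly q n := fun n => by simp [e, S.basis_eq_self hS n]; rfl
  let v : Fin 2 → ℕ → ℂ := fun j n =>
    if n = 0 then (if j = 0 then 1 else 0)
    else if n = 1 then (if j = 0 then -q.a 1 else 1) else 0
  let u : Fin 2 → ℂ[X] →ₗ[ℂ] ℂ := fun j => e.constr ℂ (v j)
  have hu : ∀ j n, u j (poly q n) = v j n := fun j n => by
    rw [← he]
    exact e.constr_basis ℂ (v j) n
  have hnorm : IsNormalized u := by
    have h0 : ∀ j, u j 1 = v j 0 := fun j => by simpa [poly] using hu j 0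
    have h1 : ∀ j, u j X = v j 1 + q.a 1 * v j 0 := fun j => by
      have hX : (X : ℂ[X]) = poly q 1 + q.a 1 • poly q 0 := by simp [poly, smul_eq_C_mul]
      rw [hX, map_add, map_smul, hu, hu, smul_eq_mul]
    ext i j
    fin_cases i <;> fin_cases j <;> simp [vecApply, vecP0, h0, h1, v]
  have hB : ∀ m, 1 ≤ m → vecApply u (vecPoly q m) = 0 := by
    intro m hm
    ext i j
    fin_cases i <;> simp [vecApply, vecPoly, hu, v] <;> omega
  refine ⟨u, ⟨hnorm, ?_⟩, ?_⟩
  · have hrec : ∀ k m, vecApply u ((X ^ (2 * (k + 1)) : ℂ[X]) • vecPoly q m)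
        = blockA q m * vecApply u ((X ^ (2 * k) : ℂ[X]) • vecPoly q (m + 1))
        + blockB q m * vecApply u ((X ^ (2 * k) : ℂ[X]) • vecPoly q m)
        + blockC q m * vecApply u ((X ^ (2 * k) : ℂ[X]) • prev (vecPoly q) m) := by
      intro k m
      rw [mul_add, pow_add, mul_smul, mul_one, vecPoly_rec, smul_add, smul_add, vecApply_add,
        vecApply_add, vecApply_mul, vecApply_mul, vecApply_mul]
    have hlow : ∀ k m, k < m → vecApply u ((X ^ (2 * k) : ℂ[X]) • vecPoly q m) = 0 := by
      intro k
      induction k with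
      | zero => intro m hm; simpa using hB m hm
      | succ k ih =>
        intro m hm
        obtain ⟨m, rfl⟩ : ∃ l, m = l + 1 := ⟨m - 1, by omega⟩
        rw [hrec, ih _ (by omega), ih _ (by omega)]
        simp [prev, ih m (by omega)]
    refine ⟨fun m => vecApply u ((X ^ (2 * m) : ℂ[X]) • vecPoly q m), ?_, ?_⟩
    · intro m
      induction m with
      | zero => simp [vecApply, vecPoly, hu, v, Matrix.det_fin_two]
      | succ m ih =>
        dsimp only at ih ⊢
        rw [hrec, hlow _ _ (by omega), hlow _ _ (by omega)]
        simp only [mul_zero, zero_add, prev, Matrix.det_mul]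
        refine mul_ne_zero ?_ ih
        simpa [blockC, Matrix.det_fin_two] using ⟨hd _ (by omega), hd _ (by omega)⟩
    · intro m k hk
      rcases hk.lt_or_eq with h | rfl
      · rw [if_neg h.ne, hlow k m h]
      · simp
  · rintro w ⟨hw, Δ, -, hΔ⟩
    funext j
    refine e.ext fun n => ?_
    rw [he, hu]
    have h0 : w j 1 = v j 0 := by
      have := congrFun (congrFun hw 0) j
      fin_cases j <;> simpa [vecApply, vecP0, v, Matrix.one_apply] using this
    have h1 : w j X = if j = 0 then 0 else 1 := by
      have := congrFun (congrFun hw 1) j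
      fin_cases j <;> simpa [vecApply, vecP0, v, Matrix.one_apply] using this
    rcases n with _ | _ | n
    · simpa [poly] using h0
    · have : poly q 1 = X - q.a 1 • (1 : ℂ[X]) := by simp [poly, smul_eq_C_mul]
      rw [this, map_sub, map_smul, h0, h1]
      fin_cases j <;> simp [v]
    · have hm := hΔ ((n + 2) / 2) 0 (by omega)
      rw [if_neg (by omega)] at hm
      rcases Nat.even_or_odd' n with ⟨l, rfl | rfl⟩
      · have h2 : (2 * l + 2) / 2 = l + 1 := by omega
        have := congrFun (congrFun hm 0) j
        rw [h2] at this
        simpa [vecApply, vecPoly, v, mul_add] using this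
      · have h2 : (2 * l + 1 + 2) / 2 = l + 1 := by omega
        have := congrFun (congrFun hm 1) j
        rw [h2] at this
        have h3 : 2 * l + 1 + 1 + 1 = 2 * (l + 1) + 1 := by ring
        simpa [vecApply, vecPoly, v, h3] using this

end KostantToda

open KostantToda

/-!
The equivalences all pass through the two functionals `v₀ = u¹ + a₁ u²`, `v₁ = u²`, which satisfy
`v_j(p_n) = δ_{jn}` and whose moments `v_j(x^{2n} p_i)` are the entries of the first two columns of
`J^n` (`dualFun_poly`, `dualFun_X_pow_mul_poly`). In terms of them, the statements about `𝒰`, about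
its moments and about the blocks `J^n_{11}` are the same linear evolution
`v̇₀ = v₀(x² ·) - b₁ v₀`, `v̇₁ = v₁(x² ·) - a₂ v₀ - b₂ v₁`, rewritten with the help of `ȧ₁ = c₁`.

The Kostant–Toda system is equivalent to `ṗ_n = -c_n p_{n-1} - d_{n-1} p_{n-2}`: this is the
compatibility of the recurrence relation with the evolution (`polyDot_add_two`). From the system to
the polynomials one uses induction on `n`; conversely, the recurrence coefficients are
differentiable because they can be read off, one after the other, from the leading coefficients of
the polynomials.

The evolution of the polynomials gives that of `v₀, v₁` by differentiating the constants `v_j(p_n)`.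
Conversely, `(p_n)` is orthogonal, in the triangular sense, to the functionals
`v₀, v₁, v₀(x² ·), v₁(x² ·), …`, and the diagonal values are products of the `d_n`, hence nonzero.
So the polynomials can be solved for from the moments, which makes them differentiable, and
differentiating the orthogonality relations identifies their derivatives
(`polyEvolution_of_dualEvolution`).

For the Markov function, the moments are bounded by a constant times `‖J‖^n`. If the system holds,
bounded coefficients are Lipschitz continuous in time uniformly in the index, so that `‖J(s)‖` stays
below a fixed radius smaller than `|z|` for `s` near `t`, and the Laurent series may be
differentiated termwise. Conversely, the differential equation for `ℱ` itself bounds `ℱ̇` uniformly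
in time and on a large circle, so the Cauchy integrals for the moments may be differentiated under
the integral sign (`hasDerivAt_laurent_coeff`).
-/

namespace KostantToda

/-! ### The Kostant–Toda system and the polynomials -/

/-- The right-hand side of the equation for `a_n` in the full Kostant–Toda system. -/
def todaA (q : Coeffs) (n : ℕ) : ℂ := q.c n - lag q.c n 2

/-- The right-hand side of the equation for `b_n` in the full Kostant–Toda system. -/
def todaB (q : Coeffs) (n : ℕ) : ℂ :=
  q.c n * q.a (n + 1) - lag q.c n 1 * q.a n + q.d n - lag q.d n 2

/-- The right-hand side of the equation for `c_n` in the full Kostant–Toda system. -/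
def todaC (q : Coeffs) (n : ℕ) : ℂ :=
  q.c n * (q.b (n + 1) - q.b n) + q.d n * q.a (n + 2) - lag q.d n 1 * q.a n

/-- The right-hand side of the equation for `d_n` in the full Kostant–Toda system. -/
def todaD (q : Coeffs) (n : ℕ) : ℂ := q.d n * (q.b (n + 2) - q.b n)

/-- The full Kostant–Toda system. -/
def TodaSystem (q : ℝ → Coeffs) : Prop :=
  ∀ t, ∀ n, 1 ≤ n →
    HasDerivAt (fun s => (q s).a n) (todaA (q t) n) t ∧
    HasDerivAt (fun s => (q s).b n) (todaB (q t) n) t ∧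
    HasDerivAt (fun s => (q s).c n) (todaC (q t) n) t ∧
    HasDerivAt (fun s => (q s).d n) (todaD (q t) n) t

/-- The sequence `0, 0, p_0, p_1, …`: the value at `n` is `p_{n-2}`, so that `p_{-1} = p_{-2} = 0`
are included and the recurrence relation needs no case distinction. -/
noncomputable def shiftedPoly (q : Coeffs) : ℕ → ℂ[X]
  | 0 => 0
  | 1 => 0
  | n + 2 => poly q n

/-- The polynomial `-c_n p_{n-1} - d_{n-1} p_{n-2}`, the expected time derivative of `p_n`. -/
noncomputable def polyDot (q : Coeffs) (n : ℕ) : ℂ[X] :=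
  -(C (q.c n) * shiftedPoly q (n + 1)) - C (q.d (n - 1)) * shiftedPoly q n

/-- The sequence `polyDot`, preceded by two zeros like `shiftedPoly`. -/
noncomputable def shiftedDot (q : Coeffs) : ℕ → ℂ[X]
  | 0 => 0
  | 1 => 0
  | n + 2 => polyDot q n

/-- The recurrence relation of the `p_n`, for all `n ≥ 0`. At `n = 0, 1` the values `c_0` and `d_0`
appear, but only with the factors `p_{-1} = p_{-2} = 0`. -/
theorem shiftedPoly_rec (q : Coeffs) (n : ℕ) :
    shiftedPoly q (n + 4) = X ^ 2 * shiftedPoly q (n + 2) - C (q.a (n + 2)) * shiftedPoly q (n + 3)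
      - C (q.b (n + 1)) * shiftedPoly q (n + 2) - C (q.c n) * shiftedPoly q (n + 1)
      - C (q.d (n - 1)) * shiftedPoly q n := by
  match n with
  | 0 => simp [shiftedPoly, poly]
  | 1 => simp [shiftedPoly, poly]
  | n + 2 => simp [shiftedPoly, poly]

/-- The compatibility condition between `ṗ_n = -c_n p_{n-1} - d_{n-1} p_{n-2}` and the time
derivative of the recurrence relation: it holds when the derivatives of the coefficients are the
right-hand sides of the Kostant–Toda system. -/
theorem polyDot_add_two (q : Coeffs) (n : ℕ) :
    polyDot q (n + 2) = X ^ 2 * shiftedDot q (n + 2)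
      - (C (todaA q (n + 2)) * shiftedPoly q (n + 3) + C (q.a (n + 2)) * shiftedDot q (n + 3))
      - (C (todaB q (n + 1)) * shiftedPoly q (n + 2) + C (q.b (n + 1)) * shiftedDot q (n + 2))
      - (C (todaC q n) * shiftedPoly q (n + 1) + C (q.c n) * shiftedDot q (n + 1))
      - (C (todaD q (n - 1)) * shiftedPoly q n + C (q.d (n - 1)) * shiftedDot q n) := by
  match n with
  | 0 =>
    simp only [polyDot, shiftedDot, shiftedPoly, todaA, todaB, todaC, todaD, lag]
    simp
    ring
  | 1 =>
    have h1 := shiftedPoly_rec q 0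
    simp only [polyDot, shiftedDot, shiftedPoly, todaA, todaB, todaC, todaD, lag] at h1 ⊢
    simp at h1 ⊢
    linear_combination -C (q.c 1) * h1
  | m + 2 =>
    have h1 := shiftedPoly_rec q (m + 1)
    have h0 := shiftedPoly_rec q m
    simp only [polyDot, shiftedDot, shiftedPoly, todaA, todaB, todaC, todaD, lag,
      Nat.add_sub_cancel, show m + 2 - 1 = m + 1 by omega, show m + 2 + 2 - 1 = m + 3 by omega,
      show m + 2 + 1 - 1 = m + 2 by omega, show m + 2 + 1 - 2 = m + 1 by omega,
      show 2 < m + 2 + 2 by omega, show 1 < m + 2 + 1 by omega, show 2 < m + 2 + 1 by omega,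
      show 1 < m + 2 by omega, if_true] at h1 h0 ⊢
    simp only [C_sub, C_add, C_mul]
    linear_combination -C (q.c (m + 2)) * h1 - C (q.d (m + 1)) * h0

/-! ### Derivatives in time of polynomials -/

namespace PolyHasDerivAt

variable {p r : ℝ → ℂ[X]} {p' r' : ℂ[X]} {t : ℝ}

theorem const (p : ℂ[X]) (t : ℝ) : PolyHasDerivAt (fun _ => p) 0 t := fun k => by
  simpa using hasDerivAt_const t (p.coeff k)

theorem congr_deriv (hp : PolyHasDerivAt p p' t) (h : p' = r') : PolyHasDerivAt p r' t := h ▸ hp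

theorem add (hp : PolyHasDerivAt p p' t) (hr : PolyHasDerivAt r r' t) :
    PolyHasDerivAt (fun s => p s + r s) (p' + r') t := fun k => by
  simpa using (hp k).fun_add (hr k)

theorem sub (hp : PolyHasDerivAt p p' t) (hr : PolyHasDerivAt r r' t) :
    PolyHasDerivAt (fun s => p s - r s) (p' - r') t := fun k => by
  simpa using (hp k).fun_sub (hr k)

theorem C_mul {f : ℝ → ℂ} {f' : ℂ} (hf : HasDerivAt f f' t) (hp : PolyHasDerivAt p p' t) :
    PolyHasDerivAt (fun s => C (f s) * p s) (C f' * p t + C (f t) * p') t := fun k => by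
  simpa using hf.fun_mul (hp k)

theorem X_sq_mul (hp : PolyHasDerivAt p p' t) :
    PolyHasDerivAt (fun s => X ^ 2 * p s) (X ^ 2 * p') t := fun k => by
  match k with
  | 0 => simpa [coeff_X_pow_mul'] using hasDerivAt_const t (0 : ℂ)
  | 1 => simpa [coeff_X_pow_mul'] using hasDerivAt_const t (0 : ℂ)
  | k + 2 => simpa [coeff_X_pow_mul] using hp k

theorem unique (h₁ : PolyHasDerivAt p p' t) (h₂ : PolyHasDerivAt p r' t) : p' = r' := by
  ext k
  exact (h₁ k).unique (h₂ k)

end PolyHasDerivAt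

/-- The equations `ṗ_n = -c_n p_{n-1} - d_{n-1} p_{n-2}`, for all `n`. -/
def PolyEvolution (q : ℝ → Coeffs) : Prop :=
  ∀ t n, PolyHasDerivAt (fun s => poly (q s) n) (polyDot (q t) n) t

theorem coeff_poly_of_lt (q : Coeffs) {n k : ℕ} (h : n < k) : (poly q n).coeff k = 0 :=
  coeff_eq_zero_of_degree_lt (by rw [degree_poly]; exact_mod_cast h)

theorem coeff_shiftedPoly_of_lt (q : Coeffs) {n k : ℕ} (h : n < k + 2) :
    (shiftedPoly q n).coeff k = 0 := by
  match n with
  | 0 => simp [shiftedPoly]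
  | 1 => simp [shiftedPoly]
  | n + 2 => exact coeff_poly_of_lt q (by omega)

theorem coeff_shiftedPoly_self (q : Coeffs) (n : ℕ) : (shiftedPoly q (n + 2)).coeff n = 1 := by
  induction n using Nat.twoStepInduction with
  | zero => simp [shiftedPoly, poly]
  | one => simp [shiftedPoly, poly, coeff_X]
  | more n ih _ =>
    rw [show n + 2 + 2 = n + 4 from rfl, shiftedPoly_rec]
    simp only [coeff_sub, coeff_C_mul, coeff_X_pow_mul, ih]
    rw [coeff_shiftedPoly_of_lt q (by omega), coeff_shiftedPoly_of_lt q (by omega),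
      coeff_shiftedPoly_of_lt q (by omega), coeff_shiftedPoly_of_lt q (by omega)]
    simp

theorem coeff_poly_self (q : Coeffs) (n : ℕ) : (poly q n).coeff n = 1 :=
  coeff_shiftedPoly_self q n

theorem coeff_polyDot_of_le (q : Coeffs) {n k : ℕ} (h : n ≤ k) : (polyDot q n).coeff k = 0 := by
  simp only [polyDot, coeff_sub, coeff_neg, coeff_C_mul]
  rw [coeff_shiftedPoly_of_lt q (by omega), coeff_shiftedPoly_of_lt q (by omega)]
  simp

theorem coeff_shiftedDot_of_le (q : Coeffs) {n k : ℕ} (h : n ≤ k + 2) :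
    (shiftedDot q n).coeff k = 0 := by
  match n with
  | 0 => simp [shiftedDot]
  | 1 => simp [shiftedDot]
  | n + 2 => exact coeff_polyDot_of_le q (by omega)

theorem PolyEvolution.shifted {q : ℝ → Coeffs} (h : PolyEvolution q) (t : ℝ) (n : ℕ) :
    PolyHasDerivAt (fun s => shiftedPoly (q s) n) (shiftedDot (q t) n) t := by
  match n with
  | 0 => exact PolyHasDerivAt.const 0 t
  | 1 => exact PolyHasDerivAt.const 0 t
  | n + 2 => exact h t n

theorem polyEvolution_of_todaSystem {q : ℝ → Coeffs} (h : TodaSystem q) : PolyEvolution q := by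
  suffices H : ∀ t n, PolyHasDerivAt (fun s => shiftedPoly (q s) n) (shiftedDot (q t) n) t from
    fun t n => H t (n + 2)
  intro t n
  induction n using Nat.strong_induction_on with
  | _ n ih =>
    match n, ih with
    | 0, _ => exact PolyHasDerivAt.const 0 t
    | 1, _ => exact PolyHasDerivAt.const 0 t
    | 2, _ =>
      refine (PolyHasDerivAt.const 1 t).congr_deriv ?_
      simp [shiftedDot, polyDot, shiftedPoly]
    | 3, _ =>
      have h1 := (PolyHasDerivAt.const X t).sub
        (PolyHasDerivAt.C_mul (h t 1 le_rfl).1 (PolyHasDerivAt.const 1 t))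
      simp only [mul_one] at h1
      refine h1.congr_deriv ?_
      simp [shiftedDot, polyDot, shiftedPoly, poly, todaA, lag]
    | n + 4, ih =>
      have hc : PolyHasDerivAt (fun s => C ((q s).c n) * shiftedPoly (q s) (n + 1))
          (C (todaC (q t) n) * shiftedPoly (q t) (n + 1)
            + C ((q t).c n) * shiftedDot (q t) (n + 1)) t := by
        -- for `n = 0` nothing is known about `c_0`, but its factor is zero
        rcases Nat.eq_zero_or_pos n with rfl | hn
        · simpa [shiftedPoly, shiftedDot] using PolyHasDerivAt.const 0 t
        · exact PolyHasDerivAt.C_mul (h t n hn).2.2.1 (ih _ (by omega))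
      have hd : PolyHasDerivAt (fun s => C ((q s).d (n - 1)) * shiftedPoly (q s) n)
          (C (todaD (q t) (n - 1)) * shiftedPoly (q t) n
            + C ((q t).d (n - 1)) * shiftedDot (q t) n) t := by
        match n, ih with
        | 0, _ => simpa [shiftedPoly, shiftedDot] using PolyHasDerivAt.const 0 t
        | 1, _ => simpa [shiftedPoly, shiftedDot] using PolyHasDerivAt.const 0 t
        | n + 2, ih => exact PolyHasDerivAt.C_mul (h t (n + 1) (by omega)).2.2.2 (ih _ (by omega))
      have H := (((((ih (n + 2) (by omega)).X_sq_mul).sub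
        (PolyHasDerivAt.C_mul (h t (n + 2) (by omega)).1 (ih (n + 3) (by omega)))).sub
        (PolyHasDerivAt.C_mul (h t (n + 1) (by omega)).2.1 (ih (n + 2) (by omega)))).sub hc).sub hd
      simp only [← shiftedPoly_rec] at H
      exact H.congr_deriv (polyDot_add_two (q t) n).symm

/-- If `e p + r` is differentiable in time, where `p` is differentiable with coefficient `1` at
`x^k` and `r` has coefficient `0` there, then `e` and `r` are both differentiable. -/
theorem PolyHasDerivAt.peel {e : ℝ → ℂ} {p r : ℝ → ℂ[X]} {e' : ℂ} {p' r' : ℂ[X]} {t : ℝ}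
    (h : PolyHasDerivAt (fun s => C (e s) * p s + r s) (C e' * p t + C (e t) * p' + r') t)
    (hp : PolyHasDerivAt p p' t) (k : ℕ) (hpk : ∀ s, (p s).coeff k = 1)
    (hpk' : p'.coeff k = 0) (hrk : ∀ s, (r s).coeff k = 0) (hrk' : r'.coeff k = 0) :
    HasDerivAt e e' t ∧ PolyHasDerivAt r r' t := by
  have he : HasDerivAt e e' t := by simpa [hpk, hpk', hrk, hrk'] using h k
  refine ⟨he, ?_⟩
  have := h.sub (PolyHasDerivAt.C_mul he hp)
  simpa using this

theorem todaSystem_of_polyEvolution {q : ℝ → Coeffs}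
    (ha : ∀ t, HasDerivAt (fun s => (q s).a 1) ((q t).c 1) t) (h : PolyEvolution q) :
    TodaSystem q := by
  have hP := h.shifted
  -- the four coefficients are differentiable, successively, as top coefficients
  have key : ∀ t n, HasDerivAt (fun s => (q s).a (n + 2)) (todaA (q t) (n + 2)) t ∧
      HasDerivAt (fun s => (q s).b (n + 1)) (todaB (q t) (n + 1)) t ∧
      (1 ≤ n → HasDerivAt (fun s => (q s).c n) (todaC (q t) n) t) ∧
      (2 ≤ n → HasDerivAt (fun s => (q s).d (n - 1)) (todaD (q t) (n - 1)) t) := by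
    intro t n
    have hrec := fun s => shiftedPoly_rec (q s) n
    have h0 := (hP t (n + 2)).X_sq_mul.sub (hP t (n + 4))
    have e0 : (fun s => X ^ 2 * shiftedPoly (q s) (n + 2) - shiftedPoly (q s) (n + 4))
      = fun s => C ((q s).a (n + 2)) * shiftedPoly (q s) (n + 3)
      + (C ((q s).b (n + 1)) * shiftedPoly (q s) (n + 2)
      + (C ((q s).c n) * shiftedPoly (q s) (n + 1)
      + C ((q s).d (n - 1)) * shiftedPoly (q s) n)) := by
        funext s; rw [hrec s]; ring
    have d0 : X ^ 2 * shiftedDot (q t) (n + 2) - shiftedDot (q t) (n + 4)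
      = C (todaA (q t) (n + 2)) * shiftedPoly (q t) (n + 3)
          + C ((q t).a (n + 2)) * shiftedDot (q t) (n + 3)
        + (C (todaB (q t) (n + 1)) * shiftedPoly (q t) (n + 2)
          + C ((q t).b (n + 1)) * shiftedDot (q t) (n + 2)
        + (C (todaC (q t) n) * shiftedPoly (q t) (n + 1)
          + C ((q t).c n) * shiftedDot (q t) (n + 1)
        + (C (todaD (q t) (n - 1)) * shiftedPoly (q t) n
          + C ((q t).d (n - 1)) * shiftedDot (q t) n))) := by
      have := polyDot_add_two (q t) n
      change shiftedDot (q t) (n + 4) = _ at this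
      rw [this]; ring
    rw [e0, d0] at h0
    have lt : ∀ {s : ℝ} {m k : ℕ}, m < k + 2 → (shiftedPoly (q s) m).coeff k = 0 :=
      fun h => coeff_shiftedPoly_of_lt _ h
    have le : ∀ {m k : ℕ}, m ≤ k + 2 → (shiftedDot (q t) m).coeff k = 0 :=
      fun h => coeff_shiftedDot_of_le _ h
    have self : ∀ {s : ℝ} {m k : ℕ}, m = k + 2 → (shiftedPoly (q s) m).coeff k = 1 := by
      rintro s m k rfl
      exact coeff_shiftedPoly_self _ k
    obtain ⟨hA, h1⟩ := h0.peel (hP t (n + 3)) (n + 1) (fun s => self (by omega)) (le (by omega))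
      (fun s => by simp only [coeff_add, coeff_C_mul]; rw [lt, lt, lt] <;> first | simp | omega)
      (by simp only [coeff_add, coeff_C_mul]
          rw [lt, lt, lt, le, le, le] <;> first | simp | omega)
    obtain ⟨hB, h2⟩ := h1.peel (hP t (n + 2)) n (fun s => self (by omega)) (le (by omega))
      (fun s => by simp only [coeff_add, coeff_C_mul]; rw [lt, lt] <;> simp)
      (by simp only [coeff_add, coeff_C_mul]
          rw [lt, lt, le, le] <;> simp)
    have hC := fun hn : 1 ≤ n => h2.peel (hP t (n + 1)) (n - 1) (fun s => self (by omega))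
      (le (by omega)) (fun s => by simp only [coeff_C_mul]; rw [lt (by omega)]; simp)
      (by simp only [coeff_add, coeff_C_mul]; rw [lt (by omega), le (by omega)]; simp)
    refine ⟨hA, hB, fun hn => (hC hn).1, fun hn => ?_⟩
    · have h3 := (hC (by omega)).2
      have h4 : PolyHasDerivAt (fun s => C ((q s).d (n - 1)) * shiftedPoly (q s) n + 0)
          (C (todaD (q t) (n - 1)) * shiftedPoly (q t) n
            + C ((q t).d (n - 1)) * shiftedDot (q t) n + 0) t := by simpa using h3
      exact (h4.peel (hP t n) (n - 2) (fun s => self (by omega)) (le (by omega))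
        (fun s => by simp) (by simp)).1
  intro t n hn
  refine ⟨?_, ?_, (key t n).2.2.1 hn, ?_⟩
  · match n, hn with
    | 1, _ => simpa [todaA, lag] using ha t
    | n + 2, _ => exact (key t n).1
  · obtain ⟨n, rfl⟩ : ∃ m, n = m + 1 := ⟨n - 1, by omega⟩
    exact (key t n).2.1
  · simpa using (key t (n + 1)).2.2.2 (by omega)


/-! ### Block forms of the evolution of the polynomials -/

/-- The expected time derivative of `ℬ_m`, in terms of the sequence `polyDot`. -/
theorem vecDot_eq (q : Coeffs) (m : ℕ) :
    -(constMat (blockC q m)).mulVec (prev (vecPoly q) m)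
      - (constMat (blockD q m)).mulVec (vecPoly q m)
      = ![polyDot q (2 * m), polyDot q (2 * m + 1)] := by
  funext i
  rcases m with _ | m <;> fin_cases i <;>
    simp [constMat, blockC, blockD, prev, vecPoly, polyDot, shiftedPoly, mul_add] <;> ring

theorem polyEvolution_iff_vecPoly (q : ℝ → Coeffs) :
    PolyEvolution q ↔ ∀ t, ∀ m, ∀ i, PolyHasDerivAt (fun s => vecPoly (q s) m i)
        ((-(constMat (blockC (q t) m)).mulVec (prev (vecPoly (q t)) m)
          - (constMat (blockD (q t) m)).mulVec (vecPoly (q t) m)) i) t := by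
  simp only [vecDot_eq]
  constructor
  · intro h t m i
    fin_cases i
    · exact h t (2 * m)
    · exact h t (2 * m + 1)
  · intro h t n
    rcases Nat.even_or_odd' n with ⟨m, rfl | rfl⟩
    · exact h t m 0
    · exact h t m 1

theorem coeff_matPoly (q : Coeffs) (m : ℕ) (i j : Fin 2) (k : ℕ) :
    (matPoly q m i j).coeff k = (vecPoly q m i).coeff (2 * k + j) := by
  fin_cases j <;> simp [matPoly, coeff_contract, coeff_divX, mul_comm]

theorem coeff_prev_matPoly (q : Coeffs) (m : ℕ) (i j : Fin 2) (k : ℕ) :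
    (prev (matPoly q) m i j).coeff k = (prev (vecPoly q) m i).coeff (2 * k + j) := by
  cases m
  · simp [prev]
  · exact coeff_matPoly q _ i j k

theorem coeff_matDot (q : Coeffs) (m : ℕ) (i j : Fin 2) (k : ℕ) :
    ((-(constMat (blockC q m) * prev (matPoly q) m) - constMat (blockD q m) * matPoly q m)
      i j).coeff k
    = ((-(constMat (blockC q m)).mulVec (prev (vecPoly q) m)
      - (constMat (blockD q m)).mulVec (vecPoly q m)) i).coeff (2 * k + j) := by
  simp only [Matrix.sub_apply, Matrix.neg_apply, Matrix.mul_apply, Pi.sub_apply, Pi.neg_apply,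
    Matrix.mulVec, dotProduct, constMat, Matrix.map_apply, Fin.sum_univ_two, coeff_sub, coeff_neg,
    coeff_add, coeff_C_mul, coeff_matPoly, coeff_prev_matPoly]

theorem vecPoly_deriv_iff_matPoly (q : ℝ → Coeffs) :
    (∀ t, ∀ m, ∀ i, PolyHasDerivAt (fun s => vecPoly (q s) m i)
        ((-(constMat (blockC (q t) m)).mulVec (prev (vecPoly (q t)) m)
          - (constMat (blockD (q t) m)).mulVec (vecPoly (q t) m)) i) t) ↔
    ∀ t, ∀ m, ∀ i j, PolyHasDerivAt (fun s => matPoly (q s) m i j)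
        ((-(constMat (blockC (q t) m) * prev (matPoly (q t)) m)
          - constMat (blockD (q t) m) * matPoly (q t) m) i j) t := by
  constructor
  · intro h t m i j k
    simp only [coeff_matDot, coeff_matPoly]
    exact h t m i _
  · intro h t m i k
    rcases Nat.even_or_odd' k with ⟨l, rfl | rfl⟩
    · have := h t m i 0 l
      simp only [coeff_matDot, coeff_matPoly] at this
      exact this
    · have := h t m i 1 l
      simp only [coeff_matDot, coeff_matPoly] at this
      exact this

/-! ### The Lax equation -/

theorem jacobi_add_two_right (q : Coeffs) (i : ℕ) : jacobi q i (i + 2) = 1 := by simp [jacobi]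

theorem jacobi_add_one_right (q : Coeffs) (i : ℕ) : jacobi q i (i + 1) = q.a (i + 2) := by
  simp [jacobi]

theorem jacobi_self (q : Coeffs) (i : ℕ) : jacobi q i i = q.b (i + 1) := by simp [jacobi]

theorem jacobi_add_one_left (q : Coeffs) (i : ℕ) : jacobi q (i + 1) i = q.c (i + 1) := by
  simp only [jacobi, Matrix.of_apply]
  rw [if_neg (by omega), if_neg (by omega), if_neg (by omega), if_pos trivial]

theorem jacobi_add_two_left (q : Coeffs) (i : ℕ) : jacobi q (i + 2) i = q.d (i + 1) := by
  simp only [jacobi, Matrix.of_apply]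
  rw [if_neg (by omega), if_neg (by omega), if_neg (by omega), if_neg (by omega), if_pos trivial]

theorem jacobi_eq_zero (q : Coeffs) {i j : ℕ} (h : i + 2 < j ∨ j + 2 < i) : jacobi q i j = 0 := by
  simp only [jacobi, Matrix.of_apply]
  repeat rw [if_neg (by omega)]

theorem jacobiMinus_of_lt (q : Coeffs) {i j : ℕ} (h : j < i) :
    jacobiMinus q i j = jacobi q i j := by simp [jacobiMinus, h]

theorem jacobiMinus_of_le (q : Coeffs) {i j : ℕ} (h : i ≤ j) : jacobiMinus q i j = 0 := by
  simp [jacobiMinus, h]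

/-- The product of `J` with an infinite matrix, row by row. -/
theorem infMul_jacobi (q : Coeffs) (B : Matrix ℕ ℕ ℂ) (i j : ℕ) :
    infMul (jacobi q) B i j = (if 2 ≤ i then q.d (i - 1) * B (i - 2) j else 0)
      + (if 1 ≤ i then q.c i * B (i - 1) j else 0) + q.b (i + 1) * B i j
      + q.a (i + 2) * B (i + 1) j + B (i + 2) j := by
  simp only [infMul, Matrix.of_apply]
  rw [tsum_eq_sum (s := Finset.Ico (i - 2) (i + 3)) (fun k hk => by
      rw [jacobi_eq_zero q (by simp only [Finset.mem_Ico] at hk; omega), zero_mul])]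
  match i with
  | 0 =>
    simp [Finset.sum_range_succ, jacobi]
  | 1 =>
    simp [Finset.sum_range_succ, jacobi]
  | i + 2 =>
    rw [Finset.sum_Ico_eq_sum_range, show i + 2 + 3 - (i + 2 - 2) = 5 by omega]
    simp [Finset.sum_range_succ, jacobi_add_two_left, jacobi_self, jacobi_add_one_right q (i + 2),
      jacobi_add_two_right q (i + 2), jacobi_add_one_left q (i + 1), add_right_comm]

/-- The product of `J_-` with an infinite matrix, row by row. -/
theorem infMul_jacobiMinus (q : Coeffs) (B : Matrix ℕ ℕ ℂ) (i j : ℕ) :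
    infMul (jacobiMinus q) B i j = (if 2 ≤ i then q.d (i - 1) * B (i - 2) j else 0)
      + (if 1 ≤ i then q.c i * B (i - 1) j else 0) := by
  simp only [infMul, Matrix.of_apply]
  rw [tsum_eq_sum (s := Finset.Ico (i - 2) i) (fun k hk => by
      simp only [Finset.mem_Ico] at hk
      rcases le_or_gt i k with h | h
      · rw [jacobiMinus_of_le q h, zero_mul]
      · rw [jacobiMinus_of_lt q h, jacobi_eq_zero q (by omega), zero_mul])]
  match i with
  | 0 => simp
  | 1 => simp [jacobiMinus, jacobi_add_one_left q 0]
  | i + 2 =>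
    rw [Finset.sum_Ico_eq_sum_range, show i + 2 - (i + 2 - 2) = 2 by omega]
    simp [Finset.sum_range_succ, jacobiMinus, jacobi_add_two_left, jacobi_add_one_left q (i + 1)]

/-- The commutator `J J_- - J_- J`. -/
noncomputable def laxRight (q : Coeffs) : Matrix ℕ ℕ ℂ :=
  infMul (jacobi q) (jacobiMinus q) - infMul (jacobiMinus q) (jacobi q)

/-- The upper triangular part of `J`. -/
noncomputable def jacobiPlus (q : Coeffs) : Matrix ℕ ℕ ℂ := jacobi q - jacobiMinus q

theorem jacobiPlus_of_lt (q : Coeffs) {i j : ℕ} (h : j < i) : jacobiPlus q i j = 0 := by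
  simp [jacobiPlus, jacobiMinus_of_lt q h]

theorem jacobiPlus_of_le (q : Coeffs) {i j : ℕ} (h : i ≤ j) :
    jacobiPlus q i j = jacobi q i j := by
  simp [jacobiPlus, jacobiMinus_of_le q h]

/-- Only the upper triangular part of `J` contributes to the products of `J_-` with `J` in the
commutator. -/
theorem laxRight_eq (q : Coeffs) (i j : ℕ) :
    laxRight q i j = -(if 2 ≤ i then q.d (i - 1) * jacobiPlus q (i - 2) j else 0)
      - (if 1 ≤ i then q.c i * jacobiPlus q (i - 1) j else 0) + q.b (i + 1) * jacobiMinus q i j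
      + q.a (i + 2) * jacobiMinus q (i + 1) j + jacobiMinus q (i + 2) j := by
  simp only [laxRight, Matrix.sub_apply, infMul_jacobi, infMul_jacobiMinus, jacobiPlus]
  split_ifs <;> ring

theorem laxRight_add_one_right (q : Coeffs) (i : ℕ) :
    laxRight q i (i + 1) = todaA q (i + 2) := by
  rw [laxRight_eq, jacobiMinus_of_le q (by omega : i ≤ i + 1), jacobiMinus_of_le q le_rfl,
    jacobiMinus_of_lt q (by omega : i + 1 < i + 2), jacobi_add_one_left q (i + 1)]
  match i with
  | 0 => simp [todaA, lag]
  | 1 => simp [todaA, lag, jacobiPlus_of_le, jacobi_add_two_right q 0]; ring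
  | i + 2 =>
    simp [todaA, lag, jacobiPlus_of_le, jacobiPlus_of_le q (by omega : i ≤ i + 3),
      jacobi_eq_zero q (by omega : i + 2 < i + 3 ∨ i + 3 + 2 < i),
      jacobi_add_two_right q (i + 1)]
    ring

theorem laxRight_self (q : Coeffs) (i : ℕ) : laxRight q i i = todaB q (i + 1) := by
  rw [laxRight_eq, jacobiMinus_of_le q le_rfl, jacobiMinus_of_lt q (by omega : i < i + 1),
    jacobiMinus_of_lt q (by omega : i < i + 2), jacobi_add_one_left, jacobi_add_two_left]
  match i with
  | 0 => simp [todaB, lag]; ring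
  | 1 => simp [todaB, lag, jacobiPlus_of_le, jacobi_add_one_right q 0]; ring
  | i + 2 =>
    simp [todaB, lag, jacobiPlus_of_le, jacobi_add_two_right q i, jacobi_add_one_right q (i + 1)]
    ring

theorem laxRight_add_one_left (q : Coeffs) (i : ℕ) :
    laxRight q (i + 1) i = todaC q (i + 1) := by
  rw [laxRight_eq, jacobiMinus_of_lt q (by omega : i < i + 1),
    jacobiMinus_of_lt q (by omega : i < i + 1 + 1), jacobiMinus_of_lt q (by omega : i < i + 1 + 2),
    jacobi_eq_zero q (i := i + 1 + 2) (by omega), jacobi_add_one_left, jacobi_add_two_left q i]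
  match i with
  | 0 => simp [todaC, lag, jacobiPlus_of_le, jacobi_self]; ring
  | i + 1 =>
    simp [todaC, lag, jacobiPlus_of_le, jacobi_self, jacobi_add_one_right q i]
    ring

theorem laxRight_add_two_left (q : Coeffs) (i : ℕ) :
    laxRight q (i + 2) i = todaD q (i + 1) := by
  rw [laxRight_eq, jacobiMinus_of_lt q (by omega : i < i + 2),
    jacobiMinus_of_lt q (by omega : i < i + 2 + 1), jacobiMinus_of_lt q (by omega : i < i + 2 + 2),
    jacobi_eq_zero q (i := i + 2 + 2) (by omega), jacobi_eq_zero q (i := i + 2 + 1) (by omega),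
    jacobi_add_two_left q i]
  simp [todaD, jacobiPlus_of_le, jacobi_self, jacobiPlus_of_lt q (by omega : i < i + 1)]
  ring

theorem laxRight_eq_zero (q : Coeffs) {i j : ℕ} (h : i + 1 < j ∨ j + 2 < i) :
    laxRight q i j = 0 := by
  rw [laxRight_eq]
  rcases h with h | h
  · rw [jacobiMinus_of_le q (by omega : i ≤ j), jacobiMinus_of_le q (by omega : i + 1 ≤ j),
      jacobiMinus_of_le q (by omega : i + 2 ≤ j)]
    match i with
    | 0 => simp
    | 1 =>
      rw [jacobiPlus_of_le q (by omega), jacobi_eq_zero q (by omega)]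
      simp
    | i + 2 =>
      rw [jacobiPlus_of_le q (by omega), jacobi_eq_zero q (by omega),
        jacobiPlus_of_le q (by omega), jacobi_eq_zero q (by omega)]
      simp
  · rw [jacobiMinus_of_lt q (by omega : j < i), jacobiMinus_of_lt q (by omega : j < i + 1),
      jacobiMinus_of_lt q (by omega : j < i + 2), jacobi_eq_zero q (by omega),
      jacobi_eq_zero q (by omega), jacobi_eq_zero q (by omega),
      jacobiPlus_of_lt q (by omega), jacobiPlus_of_lt q (by omega)]
    simp

theorem todaSystem_iff_lax {q : ℝ → Coeffs}
    (ha : ∀ t, HasDerivAt (fun s => (q s).a 1) ((q t).c 1) t) :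
    TodaSystem q ↔ ∀ t, ∀ i j, HasDerivAt (fun s => jacobi (q s) i j)
        ((infMul (jacobi (q t)) (jacobiMinus (q t))
          - infMul (jacobiMinus (q t)) (jacobi (q t))) i j) t := by
  change _ ↔ ∀ t, ∀ i j, HasDerivAt (fun s => jacobi (q s) i j) (laxRight (q t) i j) t
  constructor
  · intro h t i j
    rcases lt_or_ge (i + 2) j with h1 | h1
    · simp only [laxRight_eq_zero _ (by omega : i + 1 < j ∨ j + 2 < i),
        jacobi_eq_zero _ (by omega : i + 2 < j ∨ j + 2 < i)]
      exact hasDerivAt_const _ _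
    obtain rfl | h1 := h1.eq_or_lt
    · simp only [laxRight_eq_zero _ (by omega : i + 1 < i + 2 ∨ i + 2 + 2 < i),
        jacobi_add_two_right]
      exact hasDerivAt_const _ _
    obtain rfl | h1 := (Nat.lt_succ_iff.mp h1).eq_or_lt
    · simp only [laxRight_add_one_right, jacobi_add_one_right]
      exact (h t (i + 2) (by omega)).1
    obtain rfl | h1 := (Nat.lt_succ_iff.mp h1).eq_or_lt
    · simp only [laxRight_self, jacobi_self]
      exact (h t (j + 1) (by omega)).2.1
    obtain rfl | h1 := (Nat.succ_le_of_lt h1).eq_or_lt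
    · simp only [Nat.succ_eq_add_one, laxRight_add_one_left, jacobi_add_one_left]
      exact (h t (j + 1) (by omega)).2.2.1
    obtain rfl | h1 := (Nat.succ_le_of_lt h1).eq_or_lt
    · simp only [Nat.succ_eq_add_one, add_assoc, Nat.reduceAdd, laxRight_add_two_left,
        jacobi_add_two_left]
      exact (h t (j + 1) (by omega)).2.2.2
    · simp only [laxRight_eq_zero _ (by omega : i + 1 < j ∨ j + 2 < i),
        jacobi_eq_zero _ (by omega : i + 2 < j ∨ j + 2 < i)]
      exact hasDerivAt_const _ _
  · intro h t n hn
    obtain ⟨n, rfl⟩ : ∃ m, n = m + 1 := ⟨n - 1, by omega⟩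
    refine ⟨?_, ?_, ?_, ?_⟩
    · match n with
      | 0 => simpa [todaA, lag] using ha t
      | n + 1 => simpa only [laxRight_add_one_right, jacobi_add_one_right] using h t n (n + 1)
    · simpa only [laxRight_self, jacobi_self] using h t n n
    · simpa only [laxRight_add_one_left, jacobi_add_one_left] using h t (n + 1) n
    · simpa only [laxRight_add_two_left, jacobi_add_two_left] using h t (n + 2) n


/-! ### The functionals dual to `p_0` and `p_1` -/

/-- The functionals `v₀ = u¹ + a₁ u²` and `v₁ = u²`, for which `v_j(p_n) = δ_{jn}`. -/
noncomputable def dualFun (q : Coeffs) (u : Fin 2 → ℂ[X] →ₗ[ℂ] ℂ) : Fin 2 → ℂ[X] →ₗ[ℂ] ℂ :=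
  ![u 0 + q.a 1 • u 1, u 1]

theorem apply_one_of_isNormalized {u : Fin 2 → ℂ[X] →ₗ[ℂ] ℂ} (hn : IsNormalized u) (j : Fin 2) :
    u j 1 = if j = 0 then 1 else 0 := by
  have := congrFun (congrFun hn 0) j
  fin_cases j <;> simpa [vecApply, vecP0, Matrix.one_apply] using this

theorem apply_X_of_isNormalized {u : Fin 2 → ℂ[X] →ₗ[ℂ] ℂ} (hn : IsNormalized u) (j : Fin 2) :
    u j X = if j = 0 then 0 else 1 := by
  have := congrFun (congrFun hn 1) j
  fin_cases j <;> simpa [vecApply, vecP0, Matrix.one_apply] using this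

theorem dualFun_poly {q : Coeffs} {u : Fin 2 → ℂ[X] →ₗ[ℂ] ℂ} (hn : IsNormalized u)
    (ho : IsLeftOrthogonal u (vecPoly q)) (j : Fin 2) (n : ℕ) :
    dualFun q u j (poly q n) = if n = j then 1 else 0 := by
  have h2 : ∀ (i j : Fin 2) m, u j (vecPoly q (m + 1) i) = 0 := by
    intro i j m
    obtain ⟨Δ, -, hΔ⟩ := ho
    have := congrFun (congrFun (hΔ (m + 1) 0 (by omega)) i) j
    simpa [vecApply] using this
  match n with
  | 0 =>
    fin_cases j <;> simp [dualFun, poly, apply_one_of_isNormalized hn]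
  | 1 =>
    have : poly q 1 = X - q.a 1 • (1 : ℂ[X]) := by simp [poly, smul_eq_C_mul]
    rw [this, map_sub, map_smul]
    fin_cases j <;> simp [dualFun, apply_one_of_isNormalized hn, apply_X_of_isNormalized hn]
  | n + 2 =>
    have : ∀ j, u j (poly q (n + 2)) = 0 := by
      intro j
      rcases Nat.even_or_odd' n with ⟨m, rfl | rfl⟩
      · exact h2 0 j m
      · exact h2 1 j m
    fin_cases j <;> simp [dualFun, this]

/-- The functionals `v₀(x² ·) - b₁ v₀` and `v₁(x² ·) - a₂ v₀ - b₂ v₁`, the expected time derivatives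
of `v₀` and `v₁`. -/
noncomputable def dualDot (q : Coeffs) (u : Fin 2 → ℂ[X] →ₗ[ℂ] ℂ) : Fin 2 → ℂ[X] →ₗ[ℂ] ℂ :=
  ![dualFun q u 0 ∘ₗ LinearMap.mulLeft ℂ (X ^ 2) - q.b 1 • dualFun q u 0,
    dualFun q u 1 ∘ₗ LinearMap.mulLeft ℂ (X ^ 2) - q.a 2 • dualFun q u 0 - q.b 2 • dualFun q u 1]

theorem dualDot_zero_apply (q : Coeffs) (u : Fin 2 → ℂ[X] →ₗ[ℂ] ℂ) (p : ℂ[X]) :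
    dualDot q u 0 p = dualFun q u 0 (X ^ 2 * p) - q.b 1 * dualFun q u 0 p := rfl

theorem dualDot_one_apply (q : Coeffs) (u : Fin 2 → ℂ[X] →ₗ[ℂ] ℂ) (p : ℂ[X]) :
    dualDot q u 1 p = dualFun q u 1 (X ^ 2 * p) - q.a 2 * dualFun q u 0 p
      - q.b 2 * dualFun q u 1 p := rfl

/-- The evolution `v̇₀ = v₀(x² ·) - b₁ v₀`, `v̇₁ = v₁(x² ·) - a₂ v₀ - b₂ v₁` of the dual
functionals, tested on monomials. -/
def DualEvolution (q : ℝ → Coeffs) (u : ℝ → Fin 2 → ℂ[X] →ₗ[ℂ] ℂ) : Prop :=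
  ∀ t j k, HasDerivAt (fun s => dualFun (q s) (u s) j (X ^ k)) (dualDot (q t) (u t) j (X ^ k)) t

theorem X_sq_mul_shiftedPoly (q : Coeffs) (n : ℕ) :
    X ^ 2 * shiftedPoly q (n + 2) = shiftedPoly q (n + 4) + q.a (n + 2) • shiftedPoly q (n + 3)
      + q.b (n + 1) • shiftedPoly q (n + 2) - polyDot q n := by
  rw [shiftedPoly_rec, polyDot]
  simp only [smul_eq_C_mul]
  ring

theorem dualFun_X_sq_mul_poly {q : Coeffs} {u : Fin 2 → ℂ[X] →ₗ[ℂ] ℂ} (hn : IsNormalized u)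
    (ho : IsLeftOrthogonal u (vecPoly q)) (j : Fin 2) (n : ℕ) :
    dualFun q u j (X ^ 2 * poly q n) = q.a (n + 2) * dualFun q u j (poly q (n + 1))
      + q.b (n + 1) * dualFun q u j (poly q n) - dualFun q u j (polyDot q n) := by
  have := congrArg (dualFun q u j) (X_sq_mul_shiftedPoly q n)
  simp only [shiftedPoly, map_sub, map_add, map_smul, smul_eq_mul] at this
  rw [this, dualFun_poly hn ho j (n + 2), if_neg (by omega), zero_add]

theorem dualDot_poly {q : Coeffs} {u : Fin 2 → ℂ[X] →ₗ[ℂ] ℂ} (hn : IsNormalized u)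
    (ho : IsLeftOrthogonal u (vecPoly q)) (j : Fin 2) (n : ℕ) :
    dualDot q u j (poly q n) = -dualFun q u j (polyDot q n) := by
  fin_cases j
  · simp only [Fin.zero_eta, dualDot_zero_apply, dualFun_X_sq_mul_poly hn ho, dualFun_poly hn ho]
    rcases n with _ | n <;> simp
  · simp only [Fin.mk_one, dualDot_one_apply, dualFun_X_sq_mul_poly hn ho, dualFun_poly hn ho]
    rcases n with _ | _ | n <;> simp

/-! ### Derivatives in time of functionals -/

/-- Product rule for the value of a time dependent functional at a time dependent polynomial of
degree less than `N`. -/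
theorem hasDerivAt_apply {φ : ℝ → ℂ[X] →ₗ[ℂ] ℂ} {φ' : ℂ[X] →ₗ[ℂ] ℂ} {p : ℝ → ℂ[X]} {p' : ℂ[X]}
    {t : ℝ} {N : ℕ} (hφ : ∀ k < N, HasDerivAt (fun s => φ s (X ^ k)) (φ' (X ^ k)) t)
    (hp : PolyHasDerivAt p p' t) (hN : ∀ s k, N ≤ k → (p s).coeff k = 0) :
    HasDerivAt (fun s => φ s (p s)) (φ' (p t) + φ t p') t := by
  have hN' : ∀ k, N ≤ k → p'.coeff k = 0 := fun k hk => by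
    have := hp k
    simp only [hN _ k hk] at this
    exact this.unique (hasDerivAt_const _ _)
  have expand : ∀ (ψ : ℂ[X] →ₗ[ℂ] ℂ) (r : ℂ[X]), (∀ k, N ≤ k → r.coeff k = 0) →
      ψ r = ∑ k ∈ Finset.range N, r.coeff k * ψ (X ^ k) := by
    intro ψ r hr
    have : r = ∑ k ∈ Finset.range N, r.coeff k • X ^ k := by
      ext k
      simp only [finsetSum_coeff, coeff_smul, coeff_X_pow, smul_eq_mul, mul_ite, mul_one, mul_zero,
        Finset.sum_ite_eq, Finset.mem_range]
      split_ifs with h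
      · rfl
      · exact hr k (by omega)
    conv_lhs => rw [this]
    simp
  rw [expand φ' _ (hN t), expand (φ t) _ hN', ← Finset.sum_add_distrib]
  simp only [fun s => expand (φ s) (p s) (hN s)]
  refine HasDerivAt.fun_sum fun k hk => ?_
  have := (hp k).fun_mul (hφ k (Finset.mem_range.mp hk))
  rwa [add_comm] at this

/-- A time dependent functional is differentiable if its values at the monomials are. -/
theorem hasDerivAt_apply_const {φ : ℝ → ℂ[X] →ₗ[ℂ] ℂ} {φ' : ℂ[X] →ₗ[ℂ] ℂ} {t : ℝ}
    (hφ : ∀ k, HasDerivAt (fun s => φ s (X ^ k)) (φ' (X ^ k)) t) (p : ℂ[X]) :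
    HasDerivAt (fun s => φ s p) (φ' p) t := by
  have := hasDerivAt_apply (N := p.natDegree + 1) (fun k _ => hφ k) (PolyHasDerivAt.const p t)
    (fun _ k hk => coeff_eq_zero_of_natDegree_lt (by omega))
  simpa using this

section Functional

variable {q : ℝ → Coeffs} {u : ℝ → Fin 2 → ℂ[X] →ₗ[ℂ] ℂ}

theorem dualEvolution_of_polyEvolution (hnorm : ∀ t, IsNormalized (u t))
    (horth : ∀ t, IsLeftOrthogonal (u t) (vecPoly (q t))) (h : PolyEvolution q) :
    DualEvolution q u := by
  intro t j k
  induction k using Nat.strong_induction_on with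
  | _ k ih =>
    have h1 := hasDerivAt_apply (N := k) ih ((h t k).sub (PolyHasDerivAt.const (X ^ k) t))
      (fun s l hl => by
        obtain rfl | hl := hl.eq_or_lt
        · simp [coeff_poly_self]
        · simp [coeff_poly_of_lt _ hl, coeff_X_pow, hl.ne'])
    -- `v_j(p_k)` does not depend on time
    simp only [map_sub, dualFun_poly (hnorm _) (horth _), dualDot_poly (hnorm _) (horth _)] at h1
    have h2 := (hasDerivAt_const t (if k = j then (1 : ℂ) else 0)).fun_sub h1
    simpa using h2

/-! ### Recovering the polynomials from the functionals -/

/-- The functionals `v₀, v₁, v₀(x² ·), v₁(x² ·), v₀(x⁴ ·), …`, with respect to which the sequence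
`(p_n)` is orthogonal in the triangular sense. -/
noncomputable def momentFun (v : Fin 2 → ℂ[X] →ₗ[ℂ] ℂ) (k : ℕ) : ℂ[X] →ₗ[ℂ] ℂ :=
  v (Fin.ofNat 2 k) ∘ₗ LinearMap.mulLeft ℂ (X ^ (2 * (k / 2)))

theorem momentFun_add_two (v : Fin 2 → ℂ[X] →ₗ[ℂ] ℂ) (k : ℕ) (p : ℂ[X]) :
    momentFun v (k + 2) p = momentFun v k (X ^ 2 * p) := by
  have h1 : Fin.ofNat 2 (k + 2) = Fin.ofNat 2 k := by ext; simp
  have h2 : 2 * ((k + 2) / 2) = 2 * (k / 2) + 2 := by omega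
  simp only [momentFun, LinearMap.comp_apply, LinearMap.mulLeft_apply, h1, h2, pow_add, mul_assoc]

theorem momentFun_shiftedPoly_eq_zero {q : Coeffs} {u : Fin 2 → ℂ[X] →ₗ[ℂ] ℂ}
    (hn : IsNormalized u) (ho : IsLeftOrthogonal u (vecPoly q)) (k n : ℕ) (h : k + 2 < n) :
    momentFun (dualFun q u) k (shiftedPoly q n) = 0 := by
  induction k using Nat.twoStepInduction generalizing n with
  | zero =>
    obtain ⟨n, rfl⟩ : ∃ m, n = m + 2 := ⟨n - 2, by omega⟩
    have := dualFun_poly hn ho 0 n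
    simpa [momentFun, shiftedPoly, show n ≠ 0 by omega] using this
  | one =>
    obtain ⟨n, rfl⟩ : ∃ m, n = m + 2 := ⟨n - 2, by omega⟩
    have := dualFun_poly hn ho 1 n
    simpa [momentFun, shiftedPoly, show n ≠ 1 by omega] using this
  | more k ih _ =>
    obtain ⟨n, rfl⟩ : ∃ m, n = m + 2 := ⟨n - 2, by omega⟩
    rw [momentFun_add_two, X_sq_mul_shiftedPoly, polyDot]
    simp only [map_sub, map_add, map_smul, map_neg, ← smul_eq_C_mul]
    rw [ih _ (by omega), ih _ (by omega), ih _ (by omega), ih _ (by omega), ih _ (by omega)]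
    simp

theorem momentFun_poly_eq_zero {q : Coeffs} {u : Fin 2 → ℂ[X] →ₗ[ℂ] ℂ}
    (hn : IsNormalized u) (ho : IsLeftOrthogonal u (vecPoly q)) {k n : ℕ} (h : k < n) :
    momentFun (dualFun q u) k (poly q n) = 0 :=
  momentFun_shiftedPoly_eq_zero hn ho k (n + 2) (by omega)

theorem momentFun_add_two_poly {q : Coeffs} {u : Fin 2 → ℂ[X] →ₗ[ℂ] ℂ}
    (hn : IsNormalized u) (ho : IsLeftOrthogonal u (vecPoly q)) {k n : ℕ} (h : k < n) :
    momentFun (dualFun q u) (k + 2) (poly q n) = -momentFun (dualFun q u) k (polyDot q n) := by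
  have := congrArg (momentFun (dualFun q u) k) (X_sq_mul_shiftedPoly q n)
  simp only [map_sub, map_add, map_smul] at this
  rw [momentFun_shiftedPoly_eq_zero hn ho k _ (by omega),
    momentFun_shiftedPoly_eq_zero hn ho k _ (by omega),
    momentFun_shiftedPoly_eq_zero hn ho k _ (by omega)] at this
  rw [momentFun_add_two]
  simpa [shiftedPoly] using this

theorem momentFun_poly_self_ne_zero {q : Coeffs} {u : Fin 2 → ℂ[X] →ₗ[ℂ] ℂ}
    (hd : ∀ n, 1 ≤ n → q.d n ≠ 0) (hn : IsNormalized u) (ho : IsLeftOrthogonal u (vecPoly q))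
    (n : ℕ) : momentFun (dualFun q u) n (poly q n) ≠ 0 := by
  induction n using Nat.twoStepInduction with
  | zero => simp [momentFun, dualFun_poly hn ho]
  | one => simp [momentFun, dualFun_poly hn ho]
  | more n ih _ =>
    rw [momentFun_add_two_poly hn ho (by omega)]
    simp only [polyDot, map_sub, map_neg, ← smul_eq_C_mul, map_smul, shiftedPoly]
    rw [momentFun_poly_eq_zero hn ho (by omega)]
    simpa using ⟨hd _ (by omega), ih⟩

/-- A polynomial of degree less than `N` vanishes if the first `N` of the functionals `momentFun`
do so on it. -/
theorem eq_zero_of_momentFun {q : Coeffs} {u : Fin 2 → ℂ[X] →ₗ[ℂ] ℂ}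
    (hd : ∀ n, 1 ≤ n → q.d n ≠ 0) (hn : IsNormalized u) (ho : IsLeftOrthogonal u (vecPoly q))
    {N : ℕ} {r : ℂ[X]} (hr : ∀ k, N ≤ k → r.coeff k = 0)
    (h : ∀ k < N, momentFun (dualFun q u) k r = 0) : r = 0 := by
  induction N generalizing r with
  | zero => ext k; simpa using hr k
  | succ N ih =>
    have h0 : r - r.coeff N • poly q N = 0 := by
      refine ih (fun k hk => ?_) fun k hk => ?_
      · obtain rfl | hk := hk.eq_or_lt
        · simp [coeff_poly_self]
        · simp [coeff_poly_of_lt q hk, hr k hk]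
      · simp [h k (by omega), momentFun_poly_eq_zero hn ho hk]
    rw [sub_eq_zero] at h0
    have h1 := h N (by omega)
    rw [h0, map_smul, smul_eq_mul, mul_eq_zero] at h1
    rw [h0, h1.resolve_right (momentFun_poly_self_ne_zero hd hn ho N), zero_smul]

/-- If the functionals `momentFun` vanish on `p` up to index `k`, then the lower order terms of the
evolution of the functional with index `k` do so, too. -/
theorem momentFun_dualDot {q : Coeffs} {u : Fin 2 → ℂ[X] →ₗ[ℂ] ℂ} {k : ℕ} {p : ℂ[X]}
    (h : ∀ i ≤ k, momentFun (dualFun q u) i p = 0) :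
    momentFun (dualDot q u) k p = momentFun (dualFun q u) (k + 2) p := by
  rw [momentFun_add_two]
  have comm : X ^ 2 * (X ^ (2 * (k / 2)) * p) = X ^ (2 * (k / 2)) * (X ^ 2 * p) := by ring
  rcases Nat.even_or_odd' k with ⟨l, rfl | rfl⟩
  · have h0 := h (2 * l) le_rfl
    have e : Fin.ofNat 2 (2 * l) = 0 := by ext; simp
    simp only [momentFun, e, LinearMap.comp_apply, LinearMap.mulLeft_apply] at h0 ⊢
    rw [dualDot_zero_apply, comm, h0, mul_zero, sub_zero]
  · have h1 := h (2 * l + 1) le_rfl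
    have h0 := h (2 * l) (by omega)
    have e : Fin.ofNat 2 (2 * l) = 0 := by ext; simp
    have e' : Fin.ofNat 2 (2 * l + 1) = 1 := by ext; simp
    have e2 : 2 * l / 2 = (2 * l + 1) / 2 := by omega
    simp only [momentFun, e, e', e2, LinearMap.comp_apply, LinearMap.mulLeft_apply] at h0 h1 ⊢
    rw [dualDot_one_apply, comm, h0, h1, mul_zero, mul_zero, sub_zero, sub_zero]

theorem DualEvolution.momentFun (h : DualEvolution q u) (t : ℝ) (k : ℕ) (p : ℂ[X]) :
    HasDerivAt (fun s => momentFun (dualFun (q s) (u s)) k p)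
      (KostantToda.momentFun (dualDot (q t) (u t)) k p) t :=
  hasDerivAt_apply_const (h t _) _

/-- A time dependent polynomial of degree less than `N` is differentiable if the values of the first
`N` of the functionals `momentFun` are, provided that the polynomials `p_k` with `k < N` are
differentiable. The hypothesis `hk` serves the induction: `j` counts the remaining functionals. -/
theorem exists_polyHasDerivAt (hd : ∀ t, ∀ n, 1 ≤ n → (q t).d n ≠ 0)
    (hnorm : ∀ t, IsNormalized (u t)) (horth : ∀ t, IsLeftOrthogonal (u t) (vecPoly (q t)))
    (h : DualEvolution q u) {t : ℝ} {N : ℕ}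
    (hP : ∀ k < N, ∃ p', PolyHasDerivAt (fun s => poly (q s) k) p' t) (j k : ℕ) (hjk : j + k = N)
    {r : ℝ → ℂ[X]} (hr : ∀ s i, N ≤ i → (r s).coeff i = 0)
    (hk : ∀ s, ∀ i < k, momentFun (dualFun (q s) (u s)) i (r s) = 0)
    (hdiff : ∀ i < N, DifferentiableAt ℝ (fun s => momentFun (dualFun (q s) (u s)) i (r s)) t) :
    ∃ r', PolyHasDerivAt r r' t := by
  induction j generalizing k r with
  | zero =>
    have : r = fun _ => 0 := by
      funext s
      exact eq_zero_of_momentFun (hd s) (hnorm s) (horth s) (hr s) fun i hi => hk s i (by omega)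
    exact ⟨0, this ▸ PolyHasDerivAt.const 0 t⟩
  | succ j ih =>
    obtain ⟨p', hp'⟩ := hP k (by omega)
    have hψ : ∀ i, DifferentiableAt ℝ
        (fun s => momentFun (dualFun (q s) (u s)) i (poly (q s) k)) t := fun i =>
      (hasDerivAt_apply (N := k + 1) (fun l _ => h.momentFun t i (X ^ l)) hp'
        (fun s l hl => coeff_poly_of_lt _ (by omega))).differentiableAt
    have hne := fun s => momentFun_poly_self_ne_zero (hd s) (hnorm s) (horth s) k
    -- the coefficient of `p_k` in the expansion of `r` in the basis `(p_i)`
    set e : ℝ → ℂ := fun s => momentFun (dualFun (q s) (u s)) k (r s)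
      / momentFun (dualFun (q s) (u s)) k (poly (q s) k) with he
    have hediff : DifferentiableAt ℝ e t := (hdiff k (by omega)).fun_div (hψ k) (hne t)
    have hep := PolyHasDerivAt.C_mul hediff.hasDerivAt hp'
    obtain ⟨r', hr'⟩ := ih (k + 1) (by omega) (r := fun s => r s - C (e s) * poly (q s) k)
      (fun s i hi => by simp [hr s i hi, coeff_poly_of_lt _ (by omega : k < i)])
      (fun s i hi => by
        rw [← smul_eq_C_mul, map_sub, map_smul, smul_eq_mul]
        obtain rfl | hi := (Nat.lt_succ_iff.mp hi).eq_or_lt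
        · simp [he, div_mul_cancel₀ _ (hne s)]
        · simp [hk s i hi, momentFun_poly_eq_zero (hnorm s) (horth s) hi])
      (fun i hi => by
        simp only [← smul_eq_C_mul, map_sub, map_smul, smul_eq_mul]
        exact (hdiff i hi).fun_sub (hediff.fun_mul (hψ i)))
    exact ⟨_, by simpa using hr'.add hep⟩

theorem polyEvolution_of_dualEvolution (hd : ∀ t, ∀ n, 1 ≤ n → (q t).d n ≠ 0)
    (hnorm : ∀ t, IsNormalized (u t)) (horth : ∀ t, IsLeftOrthogonal (u t) (vecPoly (q t)))
    (h : DualEvolution q u) : PolyEvolution q := by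
  have hdiff : ∀ t n, ∃ p', PolyHasDerivAt (fun s => poly (q s) n) p' t := by
    intro t n
    induction n using Nat.strong_induction_on with
    | _ n ih =>
      obtain ⟨p', hp'⟩ := exists_polyHasDerivAt hd hnorm horth h ih n 0 rfl
        (r := fun s => poly (q s) n - X ^ n)
        (fun s l hl => by
          obtain rfl | hl := hl.eq_or_lt
          · simp [coeff_poly_self]
          · simp [coeff_poly_of_lt _ hl, coeff_X_pow, hl.ne'])
        (by simp)
        (fun i hi => by
          simp only [map_sub, momentFun_poly_eq_zero (hnorm _) (horth _) hi]
          exact (h.momentFun t i (X ^ n)).differentiableAt.const_sub 0)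
      exact ⟨_, by simpa using hp'.add (PolyHasDerivAt.const (X ^ n) t)⟩
  intro t n
  obtain ⟨p', hp'⟩ := hdiff t n
  refine hp'.congr_deriv (sub_eq_zero.mp ?_)
  refine eq_zero_of_momentFun (hd t) (hnorm t) (horth t) (N := n) (fun k hk => ?_) fun k hk => ?_
  · have h1 : HasDerivAt (fun s => (poly (q s) n).coeff k) 0 t := by
      obtain rfl | hk := hk.eq_or_lt
      · simpa only [coeff_poly_self] using hasDerivAt_const t (1 : ℂ)
      · simpa only [coeff_poly_of_lt _ hk] using hasDerivAt_const t (0 : ℂ)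
    rw [coeff_sub, (hp' k).unique h1, coeff_polyDot_of_le _ hk, sub_zero]
  · -- differentiate the orthogonality relation of `p_n` with index `k`
    have h1 := hasDerivAt_apply (N := n + 1) (fun l _ => h.momentFun t k (X ^ l)) hp'
      (fun s l hl => coeff_poly_of_lt _ (by omega))
    simp only [momentFun_poly_eq_zero (hnorm _) (horth _) hk] at h1
    have h2 := h1.unique (hasDerivAt_const _ _)
    rw [momentFun_dualDot fun i hi => momentFun_poly_eq_zero (hnorm t) (horth t) (by omega),
      momentFun_add_two_poly (hnorm t) (horth t) hk] at h2
    rw [map_sub]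
    linear_combination h2

end Functional


/-! ### Powers of `J` -/

/-- The action of `J` on sequences of elements of a module. -/
noncomputable def jacobiAct {M : Type*} [AddCommGroup M] [Module ℂ M] (q : Coeffs) (x : ℕ → M) :
    ℕ → M := fun i => ∑ k ∈ Finset.range (i + 3), jacobi q i k • x k

theorem infPow_jacobi_eq_zero (q : Coeffs) (n : ℕ) {i k : ℕ} (h : i + 2 * n < k) :
    infPow (jacobi q) n i k = 0 := by
  induction n generalizing k with
  | zero => simp [infPow, show i ≠ k by omega]
  | succ n ih =>
    simp only [infPow, infMul, Matrix.of_apply]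
    rw [tsum_congr (g := fun _ => 0), tsum_zero]
    intro l
    rcases lt_or_ge (i + 2 * n) l with hl | hl
    · rw [ih hl, zero_mul]
    · rw [jacobi_eq_zero q (by omega), mul_zero]

theorem infPow_jacobi_succ (q : Coeffs) (n i k : ℕ) :
    infPow (jacobi q) (n + 1) i k
      = ∑ l ∈ Finset.range (i + 2 * n + 1), infPow (jacobi q) n i l * jacobi q l k := by
  simp only [infPow, infMul, Matrix.of_apply]
  refine tsum_eq_sum fun l hl => ?_
  rw [infPow_jacobi_eq_zero q n (by simp only [Finset.mem_range] at hl; omega), zero_mul]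

theorem jacobiAct_iterate {M : Type*} [AddCommGroup M] [Module ℂ M] (q : Coeffs) (n : ℕ)
    (x : ℕ → M) (i : ℕ) :
    (jacobiAct q)^[n] x i
      = ∑ k ∈ Finset.range (i + 2 * n + 1), infPow (jacobi q) n i k • x k := by
  induction n generalizing x with
  | zero =>
    rw [Finset.sum_eq_single i]
    · simp [infPow]
    · intro k _ hk
      simp [infPow, hk.symm]
    · simp
  | succ n ih =>
    rw [Function.iterate_succ_apply, ih]
    have h1 : ∀ l ∈ Finset.range (i + 2 * n + 1), infPow (jacobi q) n i l • jacobiAct q x l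
        = ∑ k ∈ Finset.range (i + 2 * (n + 1) + 1),
          (infPow (jacobi q) n i l * jacobi q l k) • x k := by
      intro l hl
      rw [Finset.mem_range] at hl
      rw [jacobiAct, Finset.smul_sum]
      simp only [mul_smul]
      refine Finset.sum_subset (fun k hk => ?_) fun k _ hk => ?_
      · simp only [Finset.mem_range] at hk ⊢; omega
      · simp only [Finset.mem_range] at hk
        rw [jacobi_eq_zero q (by omega), zero_smul, smul_zero]
    rw [Finset.sum_congr rfl h1, Finset.sum_comm]
    refine Finset.sum_congr rfl fun k _ => ?_
    rw [infPow_jacobi_succ, Finset.sum_smul]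

theorem jacobiAct_poly (q : Coeffs) (i : ℕ) : jacobiAct q (poly q) i = X ^ 2 * poly q i := by
  have h := X_sq_mul_shiftedPoly q i
  match i with
  | 0 =>
    simp only [jacobiAct, Finset.sum_range_succ]
    simp only [shiftedPoly, polyDot] at h
    rw [h]
    simp [jacobi]
    abel
  | 1 =>
    simp only [jacobiAct, Finset.sum_range_succ]
    simp only [shiftedPoly, polyDot] at h
    rw [h]
    simp [jacobi, smul_eq_C_mul]
    ring
  | i + 2 =>
    simp only [jacobiAct, Finset.sum_range_succ]
    rw [Finset.sum_eq_zero fun k hk => by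
      rw [jacobi_eq_zero q (by rw [Finset.mem_range] at hk; omega), zero_smul]]
    simp only [shiftedPoly, polyDot] at h
    rw [h, jacobi_add_two_left, jacobi_add_one_left q (i + 1), jacobi_self,
      jacobi_add_one_right q (i + 2), jacobi_add_two_right q (i + 2)]
    simp [smul_eq_C_mul]
    ring

theorem jacobiAct_iterate_poly (q : Coeffs) (n i : ℕ) :
    (jacobiAct q)^[n] (poly q) i = X ^ (2 * n) * poly q i := by
  induction n generalizing i with
  | zero => simp
  | succ n ih =>
    rw [Function.iterate_succ_apply', jacobiAct]
    simp only [ih, ← mul_smul_comm]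
    rw [← Finset.mul_sum]
    have := jacobiAct_poly q i
    rw [jacobiAct] at this
    rw [this, mul_add, pow_add, mul_assoc, mul_one]

/-- The first two columns of `J^n` are moments of the dual functionals. -/
theorem dualFun_X_pow_mul_poly {q : Coeffs} {u : Fin 2 → ℂ[X] →ₗ[ℂ] ℂ} (hn : IsNormalized u)
    (ho : IsLeftOrthogonal u (vecPoly q)) (n i : ℕ) (j : Fin 2) :
    dualFun q u j (X ^ (2 * n) * poly q i) = infPow (jacobi q) n i j := by
  rw [← jacobiAct_iterate_poly, jacobiAct_iterate]
  simp only [map_sum, map_smul, dualFun_poly hn ho, smul_eq_mul, mul_ite, mul_one, mul_zero,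
    Finset.sum_ite_eq', Finset.mem_range]
  split_ifs with h
  · rfl
  · rw [infPow_jacobi_eq_zero q n (by omega)]

section Equivalences

variable {q : ℝ → Coeffs} {u : ℝ → Fin 2 → ℂ[X] →ₗ[ℂ] ℂ}

theorem X_pow_mul_poly_one (q : Coeffs) (n : ℕ) :
    X ^ n * poly q 1 = X ^ (n + 1) - q.a 1 • X ^ n := by
  simp only [poly, smul_eq_C_mul]
  ring

/-- The first row of the expected time derivative of `J^n_{11}`, in terms of the dual
functionals. -/
theorem blockPow_deriv_zero {q : Coeffs} {u : Fin 2 → ℂ[X] →ₗ[ℂ] ℂ} (hn : IsNormalized u)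
    (ho : IsLeftOrthogonal u (vecPoly q)) (n : ℕ) (j : Fin 2) :
    (block11 (infPow (jacobi q) (n + 1)) - block11 (infPow (jacobi q) n) * block11 (jacobi q)
      + block11 (infPow (jacobi q) n) * block11 (jacobiMinus q)
      - block11 (jacobiMinus q) * block11 (infPow (jacobi q) n)) 0 j
      = dualDot q u j (X ^ (2 * n) * poly q 0) := by
  have hJ := fun n => dualFun_X_pow_mul_poly hn ho n 0
  have e : X ^ 2 * (X ^ (2 * n) * poly q 0) = X ^ (2 * (n + 1)) * poly q 0 := by ring
  fin_cases j
  · simp only [Fin.zero_eta, dualDot_zero_apply, e, hJ]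
    simp [block11, Matrix.mul_apply, jacobiMinus, jacobi]
    ring
  · simp only [Fin.mk_one, dualDot_one_apply, e, hJ]
    simp [block11, Matrix.mul_apply, jacobiMinus, jacobi]
    ring

/-- The second row of the expected time derivative of `J^n_{11}`: the last term accounts for the
time dependence of `p_1 = x - a_1`. -/
theorem blockPow_deriv_one {q : Coeffs} {u : Fin 2 → ℂ[X] →ₗ[ℂ] ℂ} (hn : IsNormalized u)
    (ho : IsLeftOrthogonal u (vecPoly q)) (n : ℕ) (j : Fin 2) :
    (block11 (infPow (jacobi q) (n + 1)) - block11 (infPow (jacobi q) n) * block11 (jacobi q)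
      + block11 (infPow (jacobi q) n) * block11 (jacobiMinus q)
      - block11 (jacobiMinus q) * block11 (infPow (jacobi q) n)) 1 j
      = dualDot q u j (X ^ (2 * n) * poly q 1)
        - q.c 1 * dualFun q u j (X ^ (2 * n) * poly q 0) := by
  have hJ := fun n i => dualFun_X_pow_mul_poly hn ho n i
  have e : X ^ 2 * (X ^ (2 * n) * poly q 1) = X ^ (2 * (n + 1)) * poly q 1 := by ring
  fin_cases j
  · simp only [Fin.zero_eta, dualDot_zero_apply, e, hJ]
    simp [block11, Matrix.mul_apply, jacobiMinus, jacobi]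
    ring
  · simp only [Fin.mk_one, dualDot_one_apply, e, hJ]
    simp [block11, Matrix.mul_apply, jacobiMinus, jacobi]
    ring

theorem dualEvolution_iff_block (ha : ∀ t, HasDerivAt (fun s => (q s).a 1) ((q t).c 1) t)
    (hnorm : ∀ t, IsNormalized (u t)) (horth : ∀ t, IsLeftOrthogonal (u t) (vecPoly (q t))) :
    DualEvolution q u ↔
      ∀ t, ∀ n, MatHasDerivAt (fun s => block11 (infPow (jacobi (q s)) n))
        (block11 (infPow (jacobi (q t)) (n + 1))
          - block11 (infPow (jacobi (q t)) n) * block11 (jacobi (q t))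
          + block11 (infPow (jacobi (q t)) n) * block11 (jacobiMinus (q t))
          - block11 (jacobiMinus (q t)) * block11 (infPow (jacobi (q t)) n)) t := by
  have hJ : ∀ s n i (j : Fin 2), block11 (infPow (jacobi (q s)) n) i j
      = dualFun (q s) (u s) j (X ^ (2 * n) * poly (q s) i) := fun s n i j =>
    (dualFun_X_pow_mul_poly (hnorm s) (horth s) n i j).symm
  have h1 : ∀ s j n, dualFun (q s) (u s) j (X ^ n * poly (q s) 1)
      = dualFun (q s) (u s) j (X ^ (n + 1)) - (q s).a 1 * dualFun (q s) (u s) j (X ^ n) := by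
    intro s j n
    rw [X_pow_mul_poly_one, map_sub, map_smul, smul_eq_mul]
  have h1' : ∀ s j n, dualDot (q s) (u s) j (X ^ n * poly (q s) 1)
      = dualDot (q s) (u s) j (X ^ (n + 1)) - (q s).a 1 * dualDot (q s) (u s) j (X ^ n) := by
    intro s j n
    rw [X_pow_mul_poly_one, map_sub, map_smul, smul_eq_mul]
  constructor
  · intro h t n i j
    simp only [hJ]
    fin_cases i
    · rw [Fin.zero_eta, blockPow_deriv_zero (hnorm t) (horth t)]
      simpa [poly] using h t j (2 * n)
    · rw [Fin.mk_one, blockPow_deriv_one (hnorm t) (horth t)]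
      simp only [Fin.val_one, h1, h1']
      refine ((h t j (2 * n + 1)).fun_sub ((ha t).fun_mul (h t j (2 * n)))).congr_deriv ?_
      simp only [poly, mul_one]
      ring
  · intro h t j k
    have h0 : ∀ n, HasDerivAt (fun s => dualFun (q s) (u s) j (X ^ (2 * n)))
        (dualDot (q t) (u t) j (X ^ (2 * n))) t := by
      intro n
      have := h t n 0 j
      simp only [hJ] at this
      rw [blockPow_deriv_zero (hnorm t) (horth t)] at this
      simpa [poly] using this
    rcases Nat.even_or_odd' k with ⟨n, rfl | rfl⟩
    · exact h0 n
    · have := h t n 1 j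
      simp only [hJ] at this
      rw [blockPow_deriv_one (hnorm t) (horth t)] at this
      simp only [Fin.val_one, h1, h1'] at this
      have := this.fun_add ((ha t).fun_mul (h0 n))
      simp only [sub_add_cancel] at this
      refine this.congr_deriv ?_
      simp only [poly, mul_one]
      ring

/-! ### Evolution of the vector of functionals and of its moments -/

/-- The functionals `u^j(x² ·) - ∑ₗ u^l(·) (𝒰₁)_{lj}`, the expected time derivatives of the
`u^j`. -/
noncomputable def functionalDot (u : Fin 2 → ℂ[X] →ₗ[ℂ] ℂ) (j : Fin 2) : ℂ[X] →ₗ[ℂ] ℂ :=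
  u j ∘ₗ LinearMap.mulLeft ℂ (X ^ 2) - ∑ l, moment u 1 l j • u l

theorem functionalDot_apply (u : Fin 2 → ℂ[X] →ₗ[ℂ] ℂ) (j : Fin 2) (p : ℂ[X]) :
    functionalDot u j p = u j (X ^ 2 * p) - (u 0 p * moment u 1 0 j + u 1 p * moment u 1 1 j) := by
  simp [functionalDot, mul_comm]

/-- The evolution of the vector of functionals, tested on monomials. -/
def FunctionalEvolution (u : ℝ → Fin 2 → ℂ[X] →ₗ[ℂ] ℂ) : Prop :=
  ∀ t j k, HasDerivAt (fun s => u s j (X ^ k)) (functionalDot (u t) j (X ^ k)) t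

theorem vecApply_deriv_apply (u : Fin 2 → ℂ[X] →ₗ[ℂ] ℂ) (B : Fin 2 → ℂ[X]) (i j : Fin 2) :
    (vecApply u ((X ^ 2 : ℂ[X]) • B) - vecApply u B * moment u 1) i j
      = functionalDot u j (B i) := by
  simp [functionalDot_apply, vecApply, Matrix.mul_apply]

theorem functionalEvolution_iff_vecApply :
    FunctionalEvolution u ↔ ∀ t, ∀ B : Fin 2 → ℂ[X], MatHasDerivAt (fun s => vecApply (u s) B)
        (vecApply (u t) ((X ^ 2 : ℂ[X]) • B) - vecApply (u t) B * moment (u t) 1) t := by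
  simp only [MatHasDerivAt, vecApply_deriv_apply]
  constructor
  · intro h t B i j
    exact hasDerivAt_apply_const (h t j) (B i)
  · intro h t j k
    exact h t (fun _ => X ^ k) 0 j

theorem moment_apply (u : Fin 2 → ℂ[X] →ₗ[ℂ] ℂ) (n : ℕ) (i j : Fin 2) :
    moment u n i j = u j (X ^ (2 * n + i)) := by
  fin_cases i <;> simp [moment, vecApply, vecP0, pow_succ]

theorem moment_deriv_apply (u : Fin 2 → ℂ[X] →ₗ[ℂ] ℂ) (n : ℕ) (i j : Fin 2) :
    (moment u (n + 1) - moment u n * moment u 1) i j = functionalDot u j (X ^ (2 * n + i)) := by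
  simp only [functionalDot_apply, Matrix.sub_apply, Matrix.mul_apply, Fin.sum_univ_two]
  rw [moment_apply u (n + 1), moment_apply u n, moment_apply u n, ← pow_add]
  ring_nf

theorem functionalEvolution_iff_moment :
    FunctionalEvolution u ↔ ∀ t, ∀ n, MatHasDerivAt (fun s => moment (u s) n)
        (moment (u t) (n + 1) - moment (u t) n * moment (u t) 1) t := by
  simp only [MatHasDerivAt, moment_deriv_apply, moment_apply]
  constructor
  · intro h t n i j
    exact h t j _
  · intro h t j k
    rcases Nat.even_or_odd' k with ⟨n, rfl | rfl⟩
    · exact h t n 0 j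
    · exact h t n 1 j

/-- The two evolutions correspond to each other under `v₀ = u¹ + a₁ u²`, `v₁ = u²` and `ȧ₁ = c₁`. -/
theorem dualDot_eq {q : Coeffs} {u : Fin 2 → ℂ[X] →ₗ[ℂ] ℂ} (hn : IsNormalized u)
    (ho : IsLeftOrthogonal u (vecPoly q)) (p : ℂ[X]) :
    dualDot q u 0 p = functionalDot u 0 p + q.a 1 * functionalDot u 1 p + q.c 1 * u 1 p ∧
      dualDot q u 1 p = functionalDot u 1 p := by
  have h0 := fun j => dualFun_X_sq_mul_poly hn ho j 0
  have h1 := fun j => dualFun_X_sq_mul_poly hn ho j 1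
  simp only [polyDot, shiftedPoly, ← smul_eq_C_mul, map_sub, map_neg, map_smul,
    dualFun_poly hn ho] at h0 h1
  have e0 : X ^ 2 * poly q 0 = X ^ 2 := by simp [poly]
  have e1 : X ^ 2 * poly q 1 = X ^ 3 - q.a 1 • X ^ 2 := X_pow_mul_poly_one q 2
  simp only [e0, e1, map_sub, map_smul] at h0 h1
  have h00 := h0 0
  have h01 := h0 1
  have h10 := h1 0
  have h11 := h1 1
  simp [dualFun] at h00 h01 h10 h11
  have m : ∀ l j, moment u 1 l j = u j (X ^ (2 + l : ℕ)) := fun l j => moment_apply u 1 l j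
  have m0 : ∀ j, moment u 1 0 j = u j (X ^ 2) := fun j => m 0 j
  have m1 : ∀ j, moment u 1 1 j = u j (X ^ 3) := fun j => m 1 j
  rw [dualDot_zero_apply, dualDot_one_apply, functionalDot_apply, functionalDot_apply, m0, m1, m0,
    m1]
  simp only [dualFun, Matrix.cons_val_zero, Matrix.cons_val_one, LinearMap.add_apply,
    LinearMap.smul_apply, smul_eq_mul]
  constructor
  · linear_combination u 0 p * h00 + u 1 p * (h10 + q.a 1 * h00)
  · linear_combination u 0 p * h01 + u 1 p * (h11 + q.a 1 * h01)

theorem dualEvolution_iff_functionalEvolution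
    (ha : ∀ t, HasDerivAt (fun s => (q s).a 1) ((q t).c 1) t)
    (hnorm : ∀ t, IsNormalized (u t)) (horth : ∀ t, IsLeftOrthogonal (u t) (vecPoly (q t))) :
    DualEvolution q u ↔ FunctionalEvolution u := by
  constructor
  · intro h t j k
    have h1 : HasDerivAt (fun s => u s 1 (X ^ k)) (functionalDot (u t) 1 (X ^ k)) t := by
      rw [← (dualDot_eq (hnorm t) (horth t) _).2]
      exact h t 1 k
    fin_cases j
    · have h0 := (h t 0 k).fun_sub ((ha t).fun_mul h1)
      rw [(dualDot_eq (hnorm t) (horth t) _).1] at h0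
      simp [dualFun] at h0
      refine h0.congr_deriv ?_
      simp only [Fin.zero_eta]
      ring
    · exact h1
  · intro h t j k
    fin_cases j
    · have h0 := (h t 0 k).fun_add ((ha t).fun_mul (h t 1 k))
      refine HasDerivAt.congr_deriv (f := fun s => dualFun (q s) (u s) 0 (X ^ k)) h0 ?_
      simp only [Fin.zero_eta]
      rw [(dualDot_eq (hnorm t) (horth t) _).1]
      ring
    · simp only [Fin.mk_one]
      rw [(dualDot_eq (hnorm t) (horth t) _).2]
      exact h t 1 k

end Equivalences


/-! ### The norm of sequences and of infinite matrices -/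

/-- The `ℓ²` norm of a sequence, with the value `∞` when the sequence is not square summable. -/
noncomputable def l2Norm (x : ℕ → ℂ) : ℝ≥0∞ := (∑' i, ‖x i‖ₑ ^ 2) ^ (1 / 2 : ℝ)

theorem l2Norm_eq_eLpNorm (x : ℕ → ℂ) : l2Norm x = MeasureTheory.eLpNorm x 2 .count := by
  rw [MeasureTheory.eLpNorm_eq_lintegral_rpow_enorm_toReal (by norm_num) (by norm_num),
    MeasureTheory.lintegral_count, l2Norm]
  simp

theorem l2Norm_add_le (x y : ℕ → ℂ) : l2Norm (fun i => x i + y i) ≤ l2Norm x + l2Norm y := by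
  simp only [l2Norm_eq_eLpNorm]
  exact MeasureTheory.eLpNorm_add_le .of_discrete .of_discrete (by norm_num)

theorem l2Norm_smul (c : ℂ) (x : ℕ → ℂ) : l2Norm (fun i => c * x i) = ‖c‖ₑ * l2Norm x := by
  simp only [l2Norm_eq_eLpNorm]
  exact MeasureTheory.eLpNorm_const_smul c x 2 _

theorem l2Norm_le_of_norm_le {x y : ℕ → ℂ} {c : ℝ} (h : ∀ i, ‖x i‖ ≤ c * ‖y i‖) :
    l2Norm x ≤ ENNReal.ofReal c * l2Norm y := by
  simp only [l2Norm_eq_eLpNorm]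
  exact MeasureTheory.eLpNorm_le_mul_eLpNorm_of_ae_le_mul (.of_forall h) 2

theorem enorm_apply_le_l2Norm (x : ℕ → ℂ) (i : ℕ) : ‖x i‖ₑ ≤ l2Norm x := by
  rw [l2Norm, one_div, ENNReal.le_rpow_inv_iff (by norm_num), ENNReal.rpow_ofNat]
  exact ENNReal.le_tsum (f := fun i => ‖x i‖ₑ ^ 2) i

theorem l2Norm_single (j : ℕ) : l2Norm (Pi.single j 1) = 1 := by
  rw [l2Norm, tsum_eq_single j (fun i hi => by simp [hi])]
  simp

theorem l2Norm_shift_le (x : ℕ → ℂ) : l2Norm (fun i => x (i + 1)) ≤ l2Norm x := by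
  refine ENNReal.rpow_le_rpow ?_ (by norm_num)
  exact ENNReal.tsum_comp_le_tsum_of_injective (add_left_injective 1) (fun i => ‖x i‖ₑ ^ 2)

theorem l2Norm_unshift (x : ℕ → ℂ) :
    l2Norm (fun i => if 1 ≤ i then x (i - 1) else 0) = l2Norm x := by
  rw [l2Norm, tsum_eq_zero_add' ENNReal.summable]
  simp [l2Norm]

theorem l2Norm_lp (x : lp (fun _ : ℕ => ℂ) 2) : l2Norm x = ‖x‖ₑ := by
  have h := lp.norm_rpow_eq_tsum (p := 2) (by norm_num) x
  have hs := (lp.memℓp x).summable (by norm_num)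
  simp only [ENNReal.toReal_ofNat, Real.rpow_ofNat] at h hs
  have h1 : ‖x‖ₑ ^ 2 = ∑' i, ‖x i‖ₑ ^ 2 := by
    simp only [← ofReal_norm, ← ENNReal.ofReal_pow (norm_nonneg _)]
    rw [h, ENNReal.ofReal_tsum_of_nonneg (fun _ => by positivity) hs]
  rw [l2Norm, ← h1, one_div, ← ENNReal.rpow_ofNat, ENNReal.rpow_rpow_inv (by norm_num)]

theorem memℓp_of_l2Norm_ne_top {x : ℕ → ℂ} (h : l2Norm x ≠ ∞) : Memℓp x 2 := by
  have h1 : ∑' i, ‖x i‖ₑ ^ 2 ≠ ∞ := by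
    intro h0
    rw [l2Norm, h0] at h
    simp at h
  refine memℓp_gen ?_
  have h2 := ENNReal.summable_toReal h1
  simpa using h2

theorem l2Norm_mulVec_le {A : Matrix ℕ ℕ ℂ} {x : ℕ → ℂ} (hx : l2Norm x ≠ ∞) :
    l2Norm (fun i => ∑' j, A i j * x j) ≤ l2OpNorm A * l2Norm x := by
  obtain ⟨y, rfl⟩ : ∃ y : lp (fun _ : ℕ => ℂ) 2, ⇑y = x := ⟨⟨x, memℓp_of_l2Norm_ne_top hx⟩, rfl⟩
  rw [l2Norm_lp]
  rcases eq_or_ne y 0 with rfl | hy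
  · simp [l2Norm]
  · have hn : ‖y‖ ≠ 0 := norm_ne_zero_iff.mpr hy
    set c : ℂ := ((‖y‖⁻¹ : ℝ) : ℂ) with hc
    have hcn : ‖c‖ₑ * ‖y‖ₑ = 1 := by
      rw [← ofReal_norm, ← ofReal_norm, ← ENNReal.ofReal_mul (norm_nonneg _), hc,
        Complex.norm_real, norm_inv, norm_norm, inv_mul_cancel₀ hn, ENNReal.ofReal_one]
    have h1 : ‖c • y‖ ≤ 1 := by
      rw [norm_smul, hc, Complex.norm_real, norm_inv, norm_norm, inv_mul_cancel₀ hn]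
    have h2 : l2Norm (fun i => ∑' j, A i j * (c • y) j) ≤ l2OpNorm A :=
      le_iSup₂_of_le (f := fun (x : lp (fun _ : ℕ => ℂ) 2) (_ : ‖x‖ ≤ 1) =>
        (∑' i, ‖∑' j, A i j * x j‖ₑ ^ 2) ^ (1 / 2 : ℝ)) (c • y) h1 le_rfl
    have h3 : (fun i => ∑' j, A i j * (c • y) j) = fun i => c * ∑' j, A i j * y j := by
      funext i
      rw [← tsum_mul_left]
      refine tsum_congr fun j => ?_
      simp only [lp.coeFn_smul, Pi.smul_apply, smul_eq_mul]
      ring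
    rw [h3, l2Norm_smul] at h2
    calc l2Norm (fun i => ∑' j, A i j * y j)
        = ‖c‖ₑ * l2Norm (fun i => ∑' j, A i j * y j) * ‖y‖ₑ := by
          rw [mul_right_comm, hcn, one_mul]
      _ ≤ l2OpNorm A * ‖y‖ₑ := by gcongr

theorem l2OpNorm_le {A : Matrix ℕ ℕ ℂ} {C : ℝ≥0∞}
    (h : ∀ x, l2Norm x ≤ 1 → l2Norm (fun i => ∑' j, A i j * x j) ≤ C) : l2OpNorm A ≤ C := by
  refine iSup₂_le fun x hx => h x ?_
  rw [l2Norm_lp, ← ofReal_norm]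
  simpa using ENNReal.ofReal_le_ofReal hx

/-! ### Bounds for the matrix `J` -/

theorem tsum_jacobi_mul (q : Coeffs) (x : ℕ → ℂ) (i : ℕ) :
    ∑' j, jacobi q i j * x j = (if 2 ≤ i then q.d (i - 1) * x (i - 2) else 0)
      + (if 1 ≤ i then q.c i * x (i - 1) else 0) + q.b (i + 1) * x i
      + q.a (i + 2) * x (i + 1) + x (i + 2) :=
  infMul_jacobi q (Matrix.of fun k _ => x k) i 0

theorem jacobiAct_eq_tsum (q : Coeffs) (x : ℕ → ℂ) (i : ℕ) :
    jacobiAct q x i = ∑' j, jacobi q i j * x j := by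
  rw [jacobiAct, tsum_eq_sum (s := Finset.range (i + 3))]
  · rfl
  · intro k hk
    rw [jacobi_eq_zero q (by simp only [Finset.mem_range] at hk; omega), zero_mul]

/-- The four diagonals of `J` or of a difference of two such matrices that are not constant
contribute at most `4 ε` to the norm if their entries are bounded by `ε`. -/
theorem l2Norm_diagonals_le {a b c d : ℕ → ℂ} {ε : ℝ}
    (h : ∀ n, 1 ≤ n → ‖a n‖ ≤ ε ∧ ‖b n‖ ≤ ε ∧ ‖c n‖ ≤ ε ∧ ‖d n‖ ≤ ε) (x : ℕ → ℂ) :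
    l2Norm (fun i => (if 2 ≤ i then d (i - 1) * x (i - 2) else 0)
      + (if 1 ≤ i then c i * x (i - 1) else 0) + b (i + 1) * x i + a (i + 2) * x (i + 1))
      ≤ ENNReal.ofReal (4 * ε) * l2Norm x := by
  have hε : 0 ≤ ε := (norm_nonneg _).trans (h 1 le_rfl).1
  have hd : l2Norm (fun i => if 2 ≤ i then d (i - 1) * x (i - 2) else 0)
      ≤ ENNReal.ofReal ε * l2Norm x := by
    rw [← l2Norm_unshift x, ← l2Norm_unshift (fun i => if 1 ≤ i then x (i - 1) else 0)]
    refine l2Norm_le_of_norm_le fun i => ?_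
    split_ifs with h1 h2 h3 <;> try first | omega | simp
    · rw [show i - 1 - 1 = i - 2 by omega]
      exact mul_le_mul_of_nonneg_right (h _ (by omega)).2.2.2 (norm_nonneg _)
  have hc : l2Norm (fun i => if 1 ≤ i then c i * x (i - 1) else 0)
      ≤ ENNReal.ofReal ε * l2Norm x := by
    rw [← l2Norm_unshift x]
    refine l2Norm_le_of_norm_le fun i => ?_
    split_ifs with h1
    · rw [norm_mul]
      exact mul_le_mul_of_nonneg_right (h _ (by omega)).2.2.1 (norm_nonneg _)
    · simp
  have hb : l2Norm (fun i => b (i + 1) * x i) ≤ ENNReal.ofReal ε * l2Norm x := by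
    refine l2Norm_le_of_norm_le fun i => ?_
    rw [norm_mul]
    exact mul_le_mul_of_nonneg_right (h _ (by omega)).2.1 (norm_nonneg _)
  have ha : l2Norm (fun i => a (i + 2) * x (i + 1)) ≤ ENNReal.ofReal ε * l2Norm x := by
    refine le_trans (l2Norm_le_of_norm_le (y := fun i => x (i + 1)) (c := ε) fun i => ?_) ?_
    · rw [norm_mul]
      exact mul_le_mul_of_nonneg_right (h _ (by omega)).1 (norm_nonneg _)
    · gcongr
      exact l2Norm_shift_le x
  calc _ ≤ ENNReal.ofReal ε * l2Norm x + ENNReal.ofReal ε * l2Norm x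
        + ENNReal.ofReal ε * l2Norm x + ENNReal.ofReal ε * l2Norm x :=
      (l2Norm_add_le _ _).trans (add_le_add ((l2Norm_add_le _ _).trans
        (add_le_add ((l2Norm_add_le _ _).trans (add_le_add hd hc)) hb)) ha)
    _ = ENNReal.ofReal (4 * ε) * l2Norm x := by
      rw [ENNReal.ofReal_mul (by norm_num), ENNReal.ofReal_ofNat]
      ring

theorem l2OpNorm_jacobi_le {q : Coeffs} {K : ℝ}
    (h : ∀ n, 1 ≤ n → ‖q.a n‖ ≤ K ∧ ‖q.b n‖ ≤ K ∧ ‖q.c n‖ ≤ K ∧ ‖q.d n‖ ≤ K) :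
    l2OpNorm (jacobi q) ≤ ENNReal.ofReal (4 * K + 1) := by
  have hK : 0 ≤ K := (norm_nonneg _).trans (h 1 le_rfl).1
  refine l2OpNorm_le fun x hx => ?_
  simp only [tsum_jacobi_mul]
  rw [ENNReal.ofReal_add (by positivity) zero_le_one, ENNReal.ofReal_one]
  refine (l2Norm_add_le _ _).trans (add_le_add ((l2Norm_diagonals_le h x).trans ?_) ?_)
  · exact mul_le_of_le_one_right' hx
  · exact ((l2Norm_shift_le fun i => x (i + 1)).trans (l2Norm_shift_le x)).trans hx

/-- The norm of `J` depends continuously on the coefficients, uniformly in their indices. -/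
theorem l2OpNorm_jacobi_le_add {q r : Coeffs} {ε : ℝ}
    (h : ∀ n, 1 ≤ n → ‖q.a n - r.a n‖ ≤ ε ∧ ‖q.b n - r.b n‖ ≤ ε ∧ ‖q.c n - r.c n‖ ≤ ε ∧
      ‖q.d n - r.d n‖ ≤ ε) :
    l2OpNorm (jacobi q) ≤ l2OpNorm (jacobi r) + ENNReal.ofReal (4 * ε) := by
  refine l2OpNorm_le fun x hx => ?_
  have e : (fun i => ∑' j, jacobi q i j * x j) = fun i => ∑' j, jacobi r i j * x j
      + ((if 2 ≤ i then (q.d (i - 1) - r.d (i - 1)) * x (i - 2) else 0)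
      + (if 1 ≤ i then (q.c i - r.c i) * x (i - 1) else 0) + (q.b (i + 1) - r.b (i + 1)) * x i
      + (q.a (i + 2) - r.a (i + 2)) * x (i + 1)) := by
    funext i
    rw [tsum_jacobi_mul, tsum_jacobi_mul]
    split_ifs <;> ring
  rw [e]
  refine (l2Norm_add_le _ _).trans (add_le_add ?_ ?_)
  · exact (l2Norm_mulVec_le (ne_top_of_le_ne_top ENNReal.one_ne_top hx)).trans
      (mul_le_of_le_one_right' hx)
  · refine (l2Norm_diagonals_le (a := fun n => q.a n - r.a n) (b := fun n => q.b n - r.b n)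
      (c := fun n => q.c n - r.c n) (d := fun n => q.d n - r.d n) h x).trans ?_
    exact mul_le_of_le_one_right' hx

theorem enorm_infPow_jacobi_le {q : Coeffs} (hq : l2OpNorm (jacobi q) ≠ ∞) (n i j : ℕ) :
    ‖infPow (jacobi q) n i j‖ₑ ≤ l2OpNorm (jacobi q) ^ n := by
  have h1 : ∀ n, l2Norm ((jacobiAct q)^[n] (Pi.single j (1 : ℂ))) ≤ l2OpNorm (jacobi q) ^ n := by
    intro n
    induction n with
    | zero => simp [l2Norm_single]
    | succ n ih =>
      rw [Function.iterate_succ_apply']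
      have := l2Norm_mulVec_le (A := jacobi q) (ne_top_of_le_ne_top (ENNReal.pow_ne_top hq) ih)
      simp only [← jacobiAct_eq_tsum] at this
      calc _ ≤ _ := this
        _ ≤ l2OpNorm (jacobi q) * l2OpNorm (jacobi q) ^ n := by gcongr
        _ = _ := (pow_succ' _ _).symm
  have h2 : infPow (jacobi q) n i j = (jacobiAct q)^[n] (Pi.single j (1 : ℂ)) i := by
    rw [jacobiAct_iterate]
    simp only [Pi.single_apply, smul_eq_mul, mul_ite, mul_one, mul_zero, Finset.sum_ite_eq',
      Finset.mem_range]
    split_ifs with h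
    · rfl
    · exact infPow_jacobi_eq_zero q n (by omega)
  rw [h2]
  exact (enorm_apply_le_l2Norm _ i).trans (h1 n)

theorem norm_infPow_jacobi_le {q : Coeffs} {r : ℝ} (hr : 0 ≤ r)
    (hq : l2OpNorm (jacobi q) ≤ ENNReal.ofReal r) (n i j : ℕ) :
    ‖infPow (jacobi q) n i j‖ ≤ r ^ n := by
  have h := (enorm_infPow_jacobi_le (ne_top_of_le_ne_top ENNReal.ofReal_ne_top hq) n i j).trans
    (pow_le_pow_left' hq n)
  rw [← ENNReal.ofReal_pow hr, ← ofReal_norm] at h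
  exact (ENNReal.ofReal_le_ofReal_iff (by positivity)).mp h

/-- The moments `𝒰_n` grow at most like the powers of the norm of `J`. -/
theorem norm_moment_le {q : Coeffs} {u : Fin 2 → ℂ[X] →ₗ[ℂ] ℂ} (hn : IsNormalized u)
    (ho : IsLeftOrthogonal u (vecPoly q)) {K r : ℝ} (hK : ‖q.a 1‖ ≤ K) (hr : 0 ≤ r)
    (hq : l2OpNorm (jacobi q) ≤ ENNReal.ofReal r) (n : ℕ) (i j : Fin 2) :
    ‖moment u n i j‖ ≤ (1 + K) ^ 2 * r ^ n := by
  have hK0 : 0 ≤ K := (norm_nonneg _).trans hK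
  have hv : ∀ (i : ℕ) (j : Fin 2), ‖dualFun q u j (X ^ (2 * n) * poly q i)‖ ≤ r ^ n := fun i j => by
    rw [dualFun_X_pow_mul_poly hn ho]
    exact norm_infPow_jacobi_le hr hq n i j
  have hu : ∀ i (j : Fin 2), ‖u j (X ^ (2 * n) * poly q i)‖ ≤ (1 + K) * r ^ n := by
    intro i j
    fin_cases j
    · have e : u 0 (X ^ (2 * n) * poly q i) = dualFun q u 0 (X ^ (2 * n) * poly q i)
          - q.a 1 * dualFun q u 1 (X ^ (2 * n) * poly q i) := by simp [dualFun]
      rw [Fin.zero_eta, e]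
      refine (norm_sub_le _ _).trans ?_
      rw [norm_mul, add_mul, one_mul]
      gcongr
      · exact hv i 0
      · exact hv i 1
    · refine (hv i 1).trans (le_mul_of_one_le_left (by positivity) (by linarith))
  rw [moment_apply]
  fin_cases i
  · have := hu 0 j
    simp only [poly, mul_one] at this
    refine this.trans (mul_le_mul_of_nonneg_right ?_ (by positivity))
    nlinarith
  · have e : u j (X ^ (2 * n + 1)) = u j (X ^ (2 * n) * poly q 1)
        + q.a 1 * u j (X ^ (2 * n) * poly q 0) := by
      rw [X_pow_mul_poly_one]
      simp [poly]
    rw [Fin.mk_one, Fin.val_one, e]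
    refine (norm_add_le _ _).trans ?_
    rw [norm_mul]
    calc _ ≤ (1 + K) * r ^ n + K * ((1 + K) * r ^ n) := by
          gcongr
          · exact hu 1 j
          · exact hu 0 j
      _ = _ := by ring


/-! ### Laurent series depending on time -/

theorem norm_laurent_term_le {m : ℕ → ℂ} {A r : ℝ} (hm : ∀ n, ‖m n‖ ≤ A * r ^ n) {z : ℂ}
    (hz : z ≠ 0) (n : ℕ) : ‖(z ^ (n + 1))⁻¹ * m n‖ ≤ A / ‖z‖ * (r / ‖z‖) ^ n := by
  have hz' : 0 < ‖z‖ := norm_pos_iff.mpr hz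
  rw [norm_mul, norm_inv, norm_pow, div_pow, div_mul_div_comm, ← pow_succ', inv_mul_eq_div]
  gcongr
  exact hm n

theorem summable_geometric_bound {r ρ : ℝ} (A : ℝ) (hr : 0 ≤ r) (h : r < ρ) :
    Summable fun n : ℕ => A / ρ * (r / ρ) ^ n :=
  (summable_geometric_of_lt_one (by have := hr.trans_lt h; positivity)
    ((div_lt_one (hr.trans_lt h)).mpr h)).mul_left _

theorem summable_laurent {m : ℕ → ℂ} {A r : ℝ} (hr : 0 ≤ r) (hm : ∀ n, ‖m n‖ ≤ A * r ^ n) {z : ℂ}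
    (hz : r < ‖z‖) : Summable fun n => (z ^ (n + 1))⁻¹ * m n :=
  Summable.of_norm_bounded (summable_geometric_bound A hr hz)
    (norm_laurent_term_le hm (norm_pos_iff.mp (hr.trans_lt hz)))

/-- Termwise differentiation of a Laurent series. -/
theorem hasDerivAt_laurent {m v : ℝ → ℕ → ℂ} {A r δ t : ℝ} (hr : 0 ≤ r) (hδ : 0 < δ)
    (hm : ∀ n, ‖m t n‖ ≤ A * r ^ n)
    (hv : ∀ s ∈ Metric.ball t δ, ∀ n, ‖v s n‖ ≤ A * r ^ n)
    (h : ∀ s n, HasDerivAt (fun s => m s n) (v s n) s) {z : ℂ} (hz : r < ‖z‖) :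
    HasDerivAt (fun s => ∑' n, (z ^ (n + 1))⁻¹ * m s n) (∑' n, (z ^ (n + 1))⁻¹ * v t n) t := by
  have ht : t ∈ Metric.ball t δ := Metric.mem_ball_self hδ
  exact hasDerivAt_tsum_of_isPreconnected (summable_geometric_bound A hr hz) Metric.isOpen_ball
    (convex_ball t δ).isPreconnected (fun n s _ => (h s n).const_mul _)
    (fun n s hs => norm_laurent_term_le (hv s hs) (norm_pos_iff.mp (hr.trans_lt hz)) n) ht
    (summable_laurent hr hm hz) ht

/-- The integrand `z^n f(z) dz` of the Cauchy formula for the coefficients of a Laurent series `f`,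
over the circle of radius `R`. -/
noncomputable def cauchyIntegrand (R : ℝ) (n : ℕ) (f : ℂ → ℂ) (θ : ℝ) : ℂ :=
  deriv (circleMap 0 R) θ * (circleMap 0 R θ ^ n * f (circleMap 0 R θ))

theorem integral_circle_pow_mul_inv_pow {R : ℝ} (hR : R ≠ 0) (n k : ℕ) (c : ℂ) :
    ∫ θ in (0 : ℝ)..2 * Real.pi, cauchyIntegrand R n (fun z => (z ^ (k + 1))⁻¹ * c) θ
      = if k = n then 2 * Real.pi * Complex.I * c else 0 := by
  have h1 : ∮ z in C(0, R), (z - 0) ^ ((n : ℤ) - (k + 1 : ℕ))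
      = if k = n then 2 * Real.pi * Complex.I else 0 := by
    split_ifs with h
    · subst h
      rw [← circleIntegral.integral_sub_center_inv 0 hR]
      congr 1
      funext z
      rw [← zpow_neg_one]
      congr 1
      push_cast
      ring
    · exact circleIntegral.integral_sub_zpow_of_ne (by push_cast; omega) 0 0 R
  have h2 : ∀ θ, cauchyIntegrand R n (fun z => (z ^ (k + 1))⁻¹ * c) θ
      = deriv (circleMap 0 R) θ • (circleMap 0 R θ - 0) ^ ((n : ℤ) - (k + 1 : ℕ)) * c := by
    intro θ
    have h0 : circleMap 0 R θ ≠ 0 := circleMap_ne_center hR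
    rw [cauchyIntegrand, sub_zero, zpow_sub₀ h0, zpow_natCast, zpow_natCast, div_eq_mul_inv,
      smul_eq_mul]
    ring
  simp only [h2, intervalIntegral.integral_mul_const]
  rw [circleIntegral] at h1
  rw [h1]
  split_ifs <;> simp

theorem continuous_cauchyIntegrand_laurent {m : ℕ → ℂ} {A r R : ℝ} (hr : 0 ≤ r) (hrR : r < R)
    (hm : ∀ k, ‖m k‖ ≤ A * r ^ k) (n : ℕ) :
    Continuous (cauchyIntegrand R n fun z => ∑' k, (z ^ (k + 1))⁻¹ * m k) := by
  have hR : 0 < R := hr.trans_lt hrR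
  have h0 : ∀ θ, circleMap 0 R θ ≠ 0 := fun θ => circleMap_ne_center hR.ne'
  have hc : Continuous (circleMap 0 R) := continuous_circleMap 0 R
  unfold cauchyIntegrand
  simp only [deriv_circleMap]
  refine (hc.mul continuous_const).mul ((hc.pow n).mul ?_)
  refine continuous_tsum (fun k => ((hc.pow _).inv₀ fun θ => pow_ne_zero _ (h0 θ)).mul
    continuous_const) (summable_geometric_bound A hr hrR) fun k θ => ?_
  simpa [abs_of_pos hR] using norm_laurent_term_le hm (h0 θ) k

theorem norm_cauchyIntegrand_le {R B : ℝ} (hR : 0 < R) (n : ℕ) {f : ℂ → ℂ} {θ : ℝ}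
    (hf : ‖f (circleMap 0 R θ)‖ ≤ B) : ‖cauchyIntegrand R n f θ‖ ≤ R * (R ^ n * B) := by
  simp only [cauchyIntegrand, deriv_circleMap, norm_mul, norm_pow, norm_circleMap_zero,
    Complex.norm_I, mul_one, abs_of_pos hR]
  gcongr

/-- The Cauchy formula for the coefficients of a Laurent series. -/
theorem integral_cauchyIntegrand_laurent {m : ℕ → ℂ} {A r R : ℝ} (hr : 0 ≤ r) (hrR : r < R)
    (hm : ∀ k, ‖m k‖ ≤ A * r ^ k) (n : ℕ) :
    ∫ θ in (0 : ℝ)..2 * Real.pi, cauchyIntegrand R n (fun z => ∑' k, (z ^ (k + 1))⁻¹ * m k) θ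
      = 2 * Real.pi * Complex.I * m n := by
  have hR : 0 < R := hr.trans_lt hrR
  have h0 : ∀ θ, circleMap 0 R θ ≠ 0 := fun θ => circleMap_ne_center hR.ne'
  have hz : ∀ θ, ‖circleMap 0 R θ‖ = R := fun θ => by simp [abs_of_pos hR]
  have hsum := ((summable_geometric_bound A hr hrR).mul_left (R ^ n)).mul_left R
  have h := intervalIntegral.hasSum_integral_of_dominated_convergence
    (F := fun k θ => cauchyIntegrand R n (fun z => (z ^ (k + 1))⁻¹ * m k) θ)
    (f := cauchyIntegrand R n (fun z => ∑' k, (z ^ (k + 1))⁻¹ * m k))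
    (a := 0) (b := 2 * Real.pi) (μ := MeasureTheory.volume)
    (fun k _ => R * (R ^ n * (A / R * (r / R) ^ k)))
    (fun k => by
      refine Continuous.aestronglyMeasurable ?_
      unfold cauchyIntegrand
      simp only [deriv_circleMap]
      have hc : Continuous (circleMap 0 R) := continuous_circleMap 0 R
      exact (hc.mul continuous_const).mul ((hc.pow n).mul
        (((hc.pow _).inv₀ fun θ => pow_ne_zero _ (h0 θ)).mul continuous_const)))
    (fun k => .of_forall fun θ _ => norm_cauchyIntegrand_le hR n
      (by simpa only [hz] using norm_laurent_term_le hm (h0 θ) k))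
    (.of_forall fun θ _ => hsum)
    (by simp)
    (.of_forall fun θ _ => (((summable_laurent hr hm (by rwa [hz])).hasSum.mul_left _).mul_left _))
  simp only [integral_circle_pow_mul_inv_pow hR.ne'] at h
  have e : (fun k => if k = n then 2 * Real.pi * Complex.I * m k else 0)
      = fun k => if k = n then 2 * Real.pi * Complex.I * m n else 0 := by
    funext k
    split_ifs with hk
    · rw [hk]
    · rfl
  rw [e] at h
  exact h.unique (hasSum_ite_eq n _)

/-- If a Laurent series with uniformly bounded coefficients is differentiable in time at every point
of a circle, and its derivative is again such a Laurent series, then the coefficients are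
differentiable. Pointwise differentiability suffices because the derivatives are bounded uniformly
on the circle and in time. -/
theorem hasDerivAt_laurent_coeff {m v : ℝ → ℕ → ℂ} {A r R : ℝ} (hr : 0 ≤ r) (hrR : r < R)
    (hm : ∀ s n, ‖m s n‖ ≤ A * r ^ n) (hv : ∀ s n, ‖v s n‖ ≤ A * r ^ n)
    (h : ∀ s z, ‖z‖ = R → HasDerivAt (fun s => ∑' n, (z ^ (n + 1))⁻¹ * m s n)
      (∑' n, (z ^ (n + 1))⁻¹ * v s n) s) (t : ℝ) (n : ℕ) :
    HasDerivAt (fun s => m s n) (v t n) t := by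
  have hR : 0 < R := hr.trans_lt hrR
  have h0 : ∀ θ, circleMap 0 R θ ≠ 0 := fun θ => circleMap_ne_center hR.ne'
  have hz : ∀ θ, ‖circleMap 0 R θ‖ = R := fun θ => by simp [abs_of_pos hR]
  have key := (intervalIntegral.hasDerivAt_integral_of_dominated_loc_of_deriv_le
    (F := fun s => cauchyIntegrand R n (fun z => ∑' k, (z ^ (k + 1))⁻¹ * m s k))
    (F' := fun s => cauchyIntegrand R n (fun z => ∑' k, (z ^ (k + 1))⁻¹ * v s k))
    (a := 0) (b := 2 * Real.pi) (μ := MeasureTheory.volume) (s := Set.univ) (x₀ := t)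
    (bound := fun _ => R * (R ^ n * ∑' k, A / R * (r / R) ^ k))
    Filter.univ_mem
    (.of_forall fun s =>
      (continuous_cauchyIntegrand_laurent hr hrR (hm s) n).aestronglyMeasurable)
    ((continuous_cauchyIntegrand_laurent hr hrR (hm t) n).intervalIntegrable _ _)
    (continuous_cauchyIntegrand_laurent hr hrR (hv t) n).aestronglyMeasurable
    (.of_forall fun θ _ s _ => norm_cauchyIntegrand_le hR n
      (tsum_of_norm_bounded (summable_geometric_bound A hr hrR).hasSum fun k => by
        simpa only [hz] using norm_laurent_term_le (hv s) (h0 θ) k))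
    (by simp)
    (.of_forall fun θ _ s _ => ((h s _ (hz θ)).const_mul _).const_mul _)).2
  simp only [integral_cauchyIntegrand_laurent hr hrR (hm _),
    integral_cauchyIntegrand_laurent hr hrR (hv _)] at key
  have hpi : (2 * Real.pi * Complex.I : ℂ) ≠ 0 := Complex.two_pi_I_ne_zero
  have := key.const_mul (2 * Real.pi * Complex.I : ℂ)⁻¹
  simpa only [inv_mul_cancel_left₀ hpi] using this

/-! ### The generalized Markov function -/

/-- The coefficients of the expected time derivative of the generalized Markov function. -/
noncomputable def momentDot (u : Fin 2 → ℂ[X] →ₗ[ℂ] ℂ) (n : ℕ) : Matrix (Fin 2) (Fin 2) ℂ :=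
  moment u (n + 1) - moment u n * moment u 1

section Markov

variable {u : Fin 2 → ℂ[X] →ₗ[ℂ] ℂ} {A r : ℝ}

theorem norm_momentDot_le (hr : 0 ≤ r) (hA : ∀ n i j, ‖moment u n i j‖ ≤ A * r ^ n) (n : ℕ)
    (i j : Fin 2) : ‖momentDot u n i j‖ ≤ (A * r + 2 * (A * (A * r))) * r ^ n := by
  have hA0 : 0 ≤ A := by simpa using (norm_nonneg _).trans (hA 0 0 0)
  have h1 : ∀ l, ‖moment u n i l * moment u 1 l j‖ ≤ A * r ^ n * (A * r) := fun l => by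
    rw [norm_mul]
    exact mul_le_mul (hA n i l) (by simpa using hA 1 l j) (norm_nonneg _) (by positivity)
  simp only [momentDot, Matrix.sub_apply, Matrix.mul_apply, Fin.sum_univ_two]
  refine (norm_sub_le _ _).trans ((add_le_add (hA (n + 1) i j)
    ((norm_add_le _ _).trans (add_le_add (h1 0) (h1 1)))).trans (le_of_eq ?_))
  ring

theorem hasSum_markov_apply (hr : 0 ≤ r) (hA : ∀ n i j, ‖moment u n i j‖ ≤ A * r ^ n) {z : ℂ}
    (hz : r < ‖z‖) (i j : Fin 2) :
    HasSum (fun n => (z ^ (n + 1))⁻¹ * moment u n i j) (markov u z i j) := by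
  have hs : ∀ i j, Summable fun n => (z ^ (n + 1))⁻¹ * moment u n i j := fun i j =>
    summable_laurent hr (fun n => hA n i j) hz
  have h1 : Summable fun n : ℕ => (z ^ (n + 1))⁻¹ • moment u n :=
    Pi.summable.mpr fun i => Pi.summable.mpr fun j => hs i j
  exact Pi.hasSum.mp (Pi.hasSum.mp h1.hasSum i) j

theorem moment_zero (hn : IsNormalized u) : moment u 0 = 1 := by
  simpa [moment, IsNormalized] using hn

/-- The coefficientwise form of the right-hand side of the differential equation of the generalized
Markov function. -/
theorem hasSum_momentDot (hn : IsNormalized u) (hr : 0 ≤ r)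
    (hA : ∀ n i j, ‖moment u n i j‖ ≤ A * r ^ n) {z : ℂ} (hz : r < ‖z‖) (i j : Fin 2) :
    HasSum (fun n => (z ^ (n + 1))⁻¹ * momentDot u n i j)
      ((markov u z * (z • (1 : Matrix (Fin 2) (Fin 2) ℂ) - moment u 1) - 1) i j) := by
  have hz0 : z ≠ 0 := norm_pos_iff.mp (hr.trans_lt hz)
  have hF := fun l => hasSum_markov_apply hr hA hz i l
  have h1 : HasSum (fun n => (z ^ (n + 1))⁻¹ * moment u (n + 1) i j)
      (z * markov u z i j - (1 : Matrix (Fin 2) (Fin 2) ℂ) i j) := by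
    have h2 := (hasSum_nat_add_iff' 1).mpr ((hF j).mul_left z)
    simp only [Finset.sum_range_one, zero_add, pow_one, moment_zero hn,
      mul_inv_cancel_left₀ hz0] at h2
    have e : (fun n => (z ^ (n + 1))⁻¹ * moment u (n + 1) i j)
        = fun n => z * ((z ^ (n + 1 + 1))⁻¹ * moment u (n + 1) i j) := by
      funext n
      rw [pow_succ z (n + 1), mul_inv]
      field_simp
    rwa [e]
  have h3 := h1.sub (((hF 0).mul_right (moment u 1 0 j)).add ((hF 1).mul_right (moment u 1 1 j)))
  have e1 : (fun n => (z ^ (n + 1))⁻¹ * momentDot u n i j)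
      = fun n => (z ^ (n + 1))⁻¹ * moment u (n + 1) i j
        - ((z ^ (n + 1))⁻¹ * moment u n i 0 * moment u 1 0 j
          + (z ^ (n + 1))⁻¹ * moment u n i 1 * moment u 1 1 j) := by
    funext n
    simp only [momentDot, Matrix.sub_apply, Matrix.mul_apply, Fin.sum_univ_two]
    ring
  have e2 : (markov u z * (z • (1 : Matrix (Fin 2) (Fin 2) ℂ) - moment u 1) - 1) i j
      = z * markov u z i j - (1 : Matrix (Fin 2) (Fin 2) ℂ) i j
        - (markov u z i 0 * moment u 1 0 j + markov u z i 1 * moment u 1 1 j) := by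
    simp only [Matrix.mul_sub, Matrix.mul_smul, Matrix.mul_one, Matrix.sub_apply,
      Matrix.smul_apply, smul_eq_mul, Matrix.mul_apply, Fin.sum_univ_two]
    ring
  rw [e1, e2]
  exact h3

end Markov

section Evolution

variable {q : ℝ → Coeffs} {u : ℝ → Fin 2 → ℂ[X] →ₗ[ℂ] ℂ}

theorem norm_lag_le {f : ℕ → ℂ} {K : ℝ} (hf : ∀ n, 1 ≤ n → ‖f n‖ ≤ K) (n k : ℕ) :
    ‖lag f n k‖ ≤ K := by
  rw [lag]
  split_ifs with h
  · exact hf _ (by omega)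
  · simpa using (norm_nonneg _).trans (hf 1 le_rfl)

/-- Bounded solutions of the Kostant–Toda system are Lipschitz continuous in time, uniformly in the
index. -/
theorem TodaSystem.lipschitz (h : TodaSystem q) {K : ℝ}
    (hK : ∀ t, ∀ n, 1 ≤ n →
      ‖(q t).a n‖ ≤ K ∧ ‖(q t).b n‖ ≤ K ∧ ‖(q t).c n‖ ≤ K ∧ ‖(q t).d n‖ ≤ K) (s t : ℝ) (n : ℕ)
    (hn : 1 ≤ n) :
    ‖(q s).a n - (q t).a n‖ ≤ (2 * K + 4 * K ^ 2) * |s - t| ∧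
    ‖(q s).b n - (q t).b n‖ ≤ (2 * K + 4 * K ^ 2) * |s - t| ∧
    ‖(q s).c n - (q t).c n‖ ≤ (2 * K + 4 * K ^ 2) * |s - t| ∧
    ‖(q s).d n - (q t).d n‖ ≤ (2 * K + 4 * K ^ 2) * |s - t| := by
  have hK0 : 0 ≤ K := (norm_nonneg _).trans (hK 0 1 le_rfl).1
  have ha : ∀ t n, 1 ≤ n → ‖(q t).a n‖ ≤ K := fun t n hn => (hK t n hn).1
  have hb : ∀ t n, 1 ≤ n → ‖(q t).b n‖ ≤ K := fun t n hn => (hK t n hn).2.1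
  have hc : ∀ t n, 1 ≤ n → ‖(q t).c n‖ ≤ K := fun t n hn => (hK t n hn).2.2.1
  have hd : ∀ t n, 1 ≤ n → ‖(q t).d n‖ ≤ K := fun t n hn => (hK t n hn).2.2.2
  have hmul : ∀ {x y : ℂ}, ‖x‖ ≤ K → ‖y‖ ≤ K → ‖x * y‖ ≤ K * K := fun hx hy => by
    rw [norm_mul]
    exact mul_le_mul hx hy (norm_nonneg _) hK0
  have hmul2 : ∀ {x y z : ℂ}, ‖x‖ ≤ K → ‖y‖ ≤ K → ‖z‖ ≤ K → ‖x * (y - z)‖ ≤ K * (K + K) :=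
    fun hx hy hz => by
    rw [norm_mul]
    exact mul_le_mul hx ((norm_sub_le _ _).trans (add_le_add hy hz)) (norm_nonneg _) hK0
  have mvt : ∀ {f f' : ℝ → ℂ}, (∀ t, HasDerivAt f (f' t) t) → (∀ t, ‖f' t‖ ≤ 2 * K + 4 * K ^ 2) →
      ‖f s - f t‖ ≤ (2 * K + 4 * K ^ 2) * |s - t| := fun {f f'} hf hf' =>
    Convex.norm_image_sub_le_of_norm_hasDerivWithin_le
      (fun x _ => (hf x).hasDerivWithinAt) (fun x _ => hf' x) convex_univ (Set.mem_univ t)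
      (Set.mem_univ s)
  refine ⟨mvt (fun t => (h t n hn).1) fun t => ?_, mvt (fun t => (h t n hn).2.1) fun t => ?_,
    mvt (fun t => (h t n hn).2.2.1) fun t => ?_, mvt (fun t => (h t n hn).2.2.2) fun t => ?_⟩
  · have h1 := norm_sub_le ((q t).c n) (lag (q t).c n 2)
    have h2 := norm_lag_le (hc t) n 2
    have h3 := hc t n hn
    rw [todaA]
    nlinarith
  · have h1 := norm_sub_le ((q t).c n * (q t).a (n + 1) - lag (q t).c n 1 * (q t).a n + (q t).d n)
      (lag (q t).d n 2)
    have h2 := norm_add_le ((q t).c n * (q t).a (n + 1) - lag (q t).c n 1 * (q t).a n) ((q t).d n)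
    have h3 := norm_sub_le ((q t).c n * (q t).a (n + 1)) (lag (q t).c n 1 * (q t).a n)
    have h4 := hmul (hc t n hn) (ha t (n + 1) (by omega))
    have h5 := hmul (norm_lag_le (hc t) n 1) (ha t n hn)
    have h6 := norm_lag_le (hd t) n 2
    have h7 := hd t n hn
    rw [todaB]
    nlinarith
  · have h1 := norm_sub_le ((q t).c n * ((q t).b (n + 1) - (q t).b n) + (q t).d n * (q t).a (n + 2))
      (lag (q t).d n 1 * (q t).a n)
    have h2 := norm_add_le ((q t).c n * ((q t).b (n + 1) - (q t).b n))
      ((q t).d n * (q t).a (n + 2))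
    have h3 := hmul2 (hc t n hn) (hb t (n + 1) (by omega)) (hb t n hn)
    have h4 := hmul (hd t n hn) (ha t (n + 2) (by omega))
    have h5 := hmul (norm_lag_le (hd t) n 1) (ha t n hn)
    rw [todaC]
    nlinarith
  · have h1 := hmul2 (hd t n hn) (hb t (n + 2) (by omega)) (hb t n hn)
    rw [todaD]
    nlinarith

theorem markov_deriv_of_moment_deriv {K : ℝ}
    (hK : ∀ t, ∀ n, 1 ≤ n →
      ‖(q t).a n‖ ≤ K ∧ ‖(q t).b n‖ ≤ K ∧ ‖(q t).c n‖ ≤ K ∧ ‖(q t).d n‖ ≤ K)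
    (hnorm : ∀ t, IsNormalized (u t)) (horth : ∀ t, IsLeftOrthogonal (u t) (vecPoly (q t)))
    (hT : TodaSystem q)
    (hU : ∀ t, ∀ n, MatHasDerivAt (fun s => moment (u s) n)
        (moment (u t) (n + 1) - moment (u t) n * moment (u t) 1) t) :
    ∀ t, ∀ z : ℂ, l2OpNorm (jacobi (q t)) < ‖z‖ₑ →
        MatHasDerivAt (fun s => markov (u s) z)
          (markov (u t) z * (z • (1 : Matrix (Fin 2) (Fin 2) ℂ) - moment (u t) 1) - 1) t := by
  intro t z hz i j
  have hK0 : 0 ≤ K := (norm_nonneg _).trans (hK 0 1 le_rfl).1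
  set M : ℝ := 2 * K + 4 * K ^ 2 with hM
  -- a radius `r` between the norm of `J(t)` and `|z|` bounds the norms of `J(s)` for `s` near `t`
  have hfin : l2OpNorm (jacobi (q t)) ≠ ∞ := hz.ne_top
  set ρ : ℝ := (l2OpNorm (jacobi (q t))).toReal with hρ
  have hρ0 : 0 ≤ ρ := ENNReal.toReal_nonneg
  have hρz : ρ < ‖z‖ := by
    rw [← toReal_enorm]
    exact ENNReal.toReal_strict_mono enorm_ne_top hz
  set r : ℝ := (ρ + ‖z‖) / 2 with hr
  have hr0 : 0 ≤ r := by positivity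
  have hrz : r < ‖z‖ := by linarith
  set δ : ℝ := (r - ρ) / (4 * M + 1) with hδ
  have hM0 : 0 ≤ M := by positivity
  have hδ0 : 0 < δ := div_pos (by linarith) (by positivity)
  have hJ : ∀ s ∈ Metric.ball t δ, l2OpNorm (jacobi (q s)) ≤ ENNReal.ofReal r := by
    intro s hs
    refine (l2OpNorm_jacobi_le_add (hT.lipschitz hK s t)).trans ?_
    rw [← ENNReal.ofReal_toReal hfin, ← ENNReal.ofReal_add hρ0 (by positivity)]
    refine ENNReal.ofReal_le_ofReal ?_
    rw [Metric.mem_ball, Real.dist_eq, hδ, lt_div_iff₀ (by positivity)] at hs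
    have := abs_nonneg (s - t)
    linarith
  set A : ℝ := (1 + K) ^ 2
  have hA : ∀ s ∈ Metric.ball t δ, ∀ n i j, ‖moment (u s) n i j‖ ≤ A * r ^ n := fun s hs =>
    norm_moment_le (hnorm s) (horth s) (hK s 1 le_rfl).1 hr0 (hJ s hs)
  have ht := Metric.mem_ball_self (x := t) hδ0
  have h := hasDerivAt_laurent (m := fun s n => moment (u s) n i j)
    (v := fun s n => momentDot (u s) n i j) (A := max A (A * r + 2 * (A * (A * r)))) hr0 hδ0
    (fun n => (hA t ht n i j).trans (by gcongr; exact le_max_left _ _))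
    (fun s hs n => (norm_momentDot_le hr0 (hA s hs) n i j).trans
      (by gcongr; exact le_max_right _ _))
    (fun s n => hU s n i j) hrz
  rw [(hasSum_momentDot (hnorm t) hr0 (hA t ht) hrz i j).tsum_eq] at h
  refine h.congr_of_eventuallyEq ?_
  filter_upwards [Metric.ball_mem_nhds t hδ0] with s hs
  exact (hasSum_markov_apply hr0 (hA s hs) hrz i j).tsum_eq.symm

theorem moment_deriv_of_markov_deriv {K : ℝ}
    (hK : ∀ t, ∀ n, 1 ≤ n →
      ‖(q t).a n‖ ≤ K ∧ ‖(q t).b n‖ ≤ K ∧ ‖(q t).c n‖ ≤ K ∧ ‖(q t).d n‖ ≤ K)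
    (hnorm : ∀ t, IsNormalized (u t)) (horth : ∀ t, IsLeftOrthogonal (u t) (vecPoly (q t)))
    (hF : ∀ t, ∀ z : ℂ, l2OpNorm (jacobi (q t)) < ‖z‖ₑ →
        MatHasDerivAt (fun s => markov (u s) z)
          (markov (u t) z * (z • (1 : Matrix (Fin 2) (Fin 2) ℂ) - moment (u t) 1) - 1) t) :
    ∀ t, ∀ n, MatHasDerivAt (fun s => moment (u s) n)
        (moment (u t) (n + 1) - moment (u t) n * moment (u t) 1) t := by
  intro t n i j
  have hK0 : 0 ≤ K := (norm_nonneg _).trans (hK 0 1 le_rfl).1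
  set r : ℝ := 4 * K + 1 with hr
  have hr0 : 0 ≤ r := by positivity
  set A : ℝ := (1 + K) ^ 2
  have hJ := fun s => l2OpNorm_jacobi_le (hK s)
  have hA : ∀ s n i j, ‖moment (u s) n i j‖ ≤ A * r ^ n := fun s =>
    norm_moment_le (hnorm s) (horth s) (hK s 1 le_rfl).1 hr0 (hJ s)
  refine hasDerivAt_laurent_coeff (m := fun s n => moment (u s) n i j)
    (v := fun s n => momentDot (u s) n i j) (A := max A (A * r + 2 * (A * (A * r)))) hr0
    (lt_add_one r)
    (fun s n => (hA s n i j).trans (by gcongr; exact le_max_left _ _))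
    (fun s n => (norm_momentDot_le hr0 (hA s) n i j).trans (by gcongr; exact le_max_right _ _))
    (fun s z hz => ?_) t n
  have hrz : r < ‖z‖ := hz ▸ lt_add_one r
  rw [(hasSum_momentDot (hnorm s) hr0 (hA s) hrz i j).tsum_eq]
  simp only [fun s => (hasSum_markov_apply hr0 (hA s) hrz i j).tsum_eq]
  refine hF s z ((hJ s).trans_lt ?_) i j
  rw [← ofReal_norm]
  exact (ENNReal.ofReal_lt_ofReal_iff (hr0.trans_lt hrz)).mpr hrz

end Evolution

end KostantToda

theorem theorem3 (q : ℝ → Coeffs) (u : ℝ → Fin 2 → ℂ[X] →ₗ[ℂ] ℂ)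
    (hd : ∀ t, ∀ n, 1 ≤ n → (q t).d n ≠ 0)
    (hbdd : ∃ K : ℝ, ∀ t, ∀ n, 1 ≤ n →
      ‖(q t).a n‖ ≤ K ∧ ‖(q t).b n‖ ≤ K ∧ ‖(q t).c n‖ ≤ K ∧ ‖(q t).d n‖ ≤ K)
    (ha : ∀ t, HasDerivAt (fun s => (q s).a 1) ((q t).c 1) t)
    (hnorm : ∀ t, IsNormalized (u t))
    (horth : ∀ t, IsLeftOrthogonal (u t) (vecPoly (q t))) :
    List.TFAE [
      -- (a) the full Kostant-Toda system
      ∀ t, ∀ n, 1 ≤ n →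
        HasDerivAt (fun s => (q s).a n) ((q t).c n - lag (q t).c n 2) t ∧
        HasDerivAt (fun s => (q s).b n)
          ((q t).c n * (q t).a (n + 1) - lag (q t).c n 1 * (q t).a n
            + (q t).d n - lag (q t).d n 2) t ∧
        HasDerivAt (fun s => (q s).c n)
          ((q t).c n * ((q t).b (n + 1) - (q t).b n)
            + (q t).d n * (q t).a (n + 2) - lag (q t).d n 1 * (q t).a n) t ∧
        HasDerivAt (fun s => (q s).d n) ((q t).d n * ((q t).b (n + 2) - (q t).b n)) t,
      -- (a) in the form of the Lax equation
      ∀ t, ∀ i j, HasDerivAt (fun s => jacobi (q s) i j)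
        ((infMul (jacobi (q t)) (jacobiMinus (q t))
          - infMul (jacobiMinus (q t)) (jacobi (q t))) i j) t,
      -- (b)
      ∀ t, ∀ n, MatHasDerivAt (fun s => block11 (infPow (jacobi (q s)) n))
        (block11 (infPow (jacobi (q t)) (n + 1))
          - block11 (infPow (jacobi (q t)) n) * block11 (jacobi (q t))
          + block11 (infPow (jacobi (q t)) n) * block11 (jacobiMinus (q t))
          - block11 (jacobiMinus (q t)) * block11 (infPow (jacobi (q t)) n)) t,
      -- (c)
      ∀ t, ∀ n, MatHasDerivAt (fun s => moment (u s) n)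
        (moment (u t) (n + 1) - moment (u t) n * moment (u t) 1) t,
      -- (d)
      ∀ t, ∀ z : ℂ, l2OpNorm (jacobi (q t)) < ‖z‖ₑ →
        MatHasDerivAt (fun s => markov (u s) z)
          (markov (u t) z * (z • (1 : Matrix (Fin 2) (Fin 2) ℂ) - moment (u t) 1) - 1) t,
      -- (e)
      ∀ t, ∀ B : Fin 2 → ℂ[X], MatHasDerivAt (fun s => vecApply (u s) B)
        (vecApply (u t) ((X ^ 2 : ℂ[X]) • B) - vecApply (u t) B * moment (u t) 1) t,
      -- (f)
      ∀ t, ∀ m, ∀ i, PolyHasDerivAt (fun s => vecPoly (q s) m i)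
        ((-(constMat (blockC (q t) m)).mulVec (prev (vecPoly (q t)) m)
          - (constMat (blockD (q t) m)).mulVec (vecPoly (q t) m)) i) t,
      -- (g)
      ∀ t, ∀ m, ∀ i j, PolyHasDerivAt (fun s => matPoly (q s) m i j)
        ((-(constMat (blockC (q t) m) * prev (matPoly (q t)) m)
          - constMat (blockD (q t) m) * matPoly (q t) m) i j) t] := by
  obtain ⟨K, hK⟩ := hbdd
  have hTP : TodaSystem q ↔ PolyEvolution q :=
    ⟨polyEvolution_of_todaSystem, todaSystem_of_polyEvolution ha⟩
  have hPD : PolyEvolution q ↔ DualEvolution q u :=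
    ⟨dualEvolution_of_polyEvolution hnorm horth, polyEvolution_of_dualEvolution hd hnorm horth⟩
  have hDF := dualEvolution_iff_functionalEvolution ha hnorm horth
  have hTF : TodaSystem q ↔ FunctionalEvolution u := (hTP.trans hPD).trans hDF
  tfae_have 1 ↔ 2 := todaSystem_iff_lax ha
  tfae_have 1 ↔ 7 := hTP.trans (polyEvolution_iff_vecPoly q)
  tfae_have 7 ↔ 8 := vecPoly_deriv_iff_matPoly q
  tfae_have 1 ↔ 3 := (hTP.trans hPD).trans (dualEvolution_iff_block ha hnorm horth)
  tfae_have 1 ↔ 4 := hTF.trans functionalEvolution_iff_moment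
  tfae_have 1 ↔ 6 := hTF.trans functionalEvolution_iff_vecApply
  tfae_have 4 → 5 := fun h => markov_deriv_of_moment_deriv hK hnorm horth
    (hTF.mpr (functionalEvolution_iff_moment.mpr h)) h
  tfae_have 5 → 4 := moment_deriv_of_markov_deriv hK hnorm horth
  tfae_finish
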